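/- Let $k$ be a field; all algebras (associative, unital), coalgebras, linear maps and tensor products are over $k$. **Crossed products.** Let $A$ be an algebra with multiplication $\mu$, $V$ a vector space with a distinguished element $1_V$, and let $R:V\otimes A\to A\otimes V$, $\sigma:V\otimes V\to A\otimes V$ be linear maps. We say that $A\otimes_{R,\sigma}V$ is a crossed product if, for all $a\in A$, $v\in V$, $R(1_V\otimes a)=a\otimes 1_V$, $R(v\otimes 1_A)=1_A\otimes v$, $\sigma(1_V\otimes v)=\sigma(v\otimes 1_V)=1_A\otimes v$, and $$R(\mathrm{id}\otimes\mu)=(\mu\otimes\mathrm{id})(\mathrm{id}\otimes R)(R\otimes\mathrm{id}),$$ $$(\mu\otimes\mathrm{id})(\mathrm{id}\otimes\sigma)(R\otimes\mathrm{id})(\mathrm{id}\otimes\sigma)=(\mu\otimes\mathrm{id})(\mathrm{id}\otimes\sigma)(\sigma\otimes\mathrm{id}),$$ $$(\mu\otimes\mathrm{id})(\mathrm{id}\otimes\sigma)(R\otimes\mathrm{id})(\mathrm{id}\otimes R)=(\mu\otimes\mathrm{id})(\mathrm{id}\otimes R)(\sigma\otimes\mathrm{id}).$$ Then $A\otimes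 V$ with multiplication $(\mu_2\otimes\mathrm{id})(\mathrm{id}\otimes\mathrm{id}\otimes\sigma)(\mathrm{id}\otimes R\otimes\mathrm{id})$, $\mu_2=\mu(\mathrm{id}\otimes\mu)$, and unit $1_A\otimes 1_V$ is an algebra, denoted $A\otimes_{R,\sigma}V$. For linear maps $\theta,\gamma:V\to A\otimes V$, put $$R'=(\mu_2\otimes \mathrm{id})(\mathrm{id}\otimes\mathrm{id}\otimes\gamma)(\mathrm{id}\otimes R)(\theta\otimes\mathrm{id}),$$ $$\sigma'=(\mu\otimes\mathrm{id})(\mathrm{id}\otimes\gamma)(\mu_2\otimes\mathrm{id})(\mathrm{id}\otimes\mathrm{id}\otimes\sigma)(\mathrm{id}\otimes R\otimes\mathrm{id})(\theta\otimes\theta).$$ The *twisting conditions* for $\theta,\gamma$ are: $\theta(1_V)=\gamma(1_V)=1_A\otimes 1_V$; $(\mu\otimes\mathrm{id})(\mathrm{id}\otimes\gamma)\theta(v)=1_A\otimes v=(\mu\otimes\mathrm{id})(\mathrm{id}\otimes\theta)\gamma(v)$ for all $v\in V$; and $$(\mu\otimes\mathrm{id})(\mu\otimes\sigma')(\mathrm{id}\otimes\gamma\otimes\mathrm{id})(R\otimes\mathrm{id})(\mathrm{id}\otimes\gamma)=(\mu\otimes\mathrm{id})(\mathrm{id}\otimes\gamma)\sigma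 .$$ **Crossed products by a coalgebra.** Entwining data $(P,C,\Psi,e,\Psi^C)$ consist of an algebra $P$, a coalgebra $C$ with a group-like element $e$, and linear maps $\Psi:C\otimes P\to P\otimes C$, $\Psi^C:C\otimes C\to C\otimes C$ with $\Psi(\mathrm{id}\otimes\mu)=(\mu\otimes\mathrm{id})\Psi_{23}\Psi_{12}$, $\Psi(c\otimes 1)=1\otimes c$, $(\mathrm{id}\otimes\Delta)\Psi=\Psi_{12}\Psi_{23}(\Delta\otimes\mathrm{id})$, $(\mathrm{id}\otimes\varepsilon)\Psi=\varepsilon\otimes\mathrm{id}$, $(\mathrm{id}\otimes\Delta)\Psi^C=\Psi^C_{12}\Psi^C_{23}(\Delta\otimes\mathrm{id})$, $(\mathrm{id}\otimes\varepsilon)\Psi^C=\varepsilon\otimes\mathrm{id}$ and $\Psi^C(e\otimes c)=\Delta(c)$. Write $\Psi(c\otimes u)=u_\alpha\otimes c^\alpha$ and $\Psi^C(c\otimes d)=d_\beta\otimes c^\beta$ (summation understood). Let $A=\{u\in P:\Psi(e\otimes u)=u\otimes e\}$, a subalgebra of $P$. For linear maps $F:C\otimes P\to P$ and $f:C\otimes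 C\to A$ put $$R_F=(F\otimes\mathrm{id})(\mathrm{id}\otimes\Psi)(\Delta\otimes\mathrm{id}_A),\qquad \sigma_f=(f\otimes\mathrm{id})(\mathrm{id}\otimes\Psi^C)(\Delta\otimes\mathrm{id}).$$ We say that $A\rtimes_{F,f}C$ is a crossed product by a coalgebra if $R_F$ maps $C\otimes A$ into $A\otimes C$ and $A\otimes_{R_F,\sigma_f}C$ is a crossed product, with distinguished element $e$ of $C$; then $A\rtimes_{F,f}C$ denotes this algebra. **Theorem.** Let $(P,C,\Psi,e,\Psi^C)$ be entwining data and let $A\rtimes_{F,f}C$ be a crossed product by a coalgebra. Let $\nu:C\to A$ be a convolution invertible linear map, with convolution inverse $\nu^{-1}$, such that $\nu(e)=1$ and $$\Psi^C_{23}\circ\Psi_{12}\circ(\mathrm{id}_C\otimes\nu\otimes\mathrm{id}_C)\circ(\mathrm{id}_C\otimes\Delta)=(\nu\otimes\mathrm{id}_C\otimes\mathrm{id}_C)\circ(\Delta\otimes\mathrm{id}_C)\circ\Psi^C .$$ Put $\theta(c)=\nu(c_1)\otimes c_2$, $\gamma(c)=\nu^{-1}(c_1)\otimes c_2$, and define $F_\nu:C\otimes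 P\to P$ and $f_\nu:C\otimes C\to A$ by $$F_\nu(c\otimes u)=\nu(c_1)\,F(c_2\otimes u_\alpha)\,\nu^{-1}(c_3{}^{\alpha}),$$ $$f_\nu(c\otimes d)=\nu(c_1)\,F(c_2\otimes\nu(d_1)_\alpha)\,f\big((c_3{}^{\alpha})_1\otimes (d_2)_\beta\big)\,\nu^{-1}\big(((c_3{}^{\alpha})_2)^{\beta}\big).$$ Then: 1. $\theta$ and $\gamma$ satisfy the twisting conditions for $A\otimes_{R_F,\sigma_f}C$, and the resulting $A\otimes_{R_F',\sigma_f'}C$ is a crossed product; 2. $A\rtimes_{F_\nu,f_\nu}C$ is a crossed product by a coalgebra, and $R_F'=R_{F_\nu}$, $\sigma_f'=\sigma_{f_\nu}$; 3. $a\otimes c\mapsto a\,\nu(c_1)\otimes c_2$ is an isomorphism of algebras $A\rtimes_{F_\nu,f_\nu}C\to A\rtimes_{F,f}C$. -/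

import Mathlib

open scoped TensorProduct

noncomputable section

namespace CrossedProd

/-! ### General crossed products `A ⊗_{R,σ} V` -/

section General

variable {k A V : Type*} [Field k] [Ring A] [Algebra k A] [AddCommGroup V] [Module k V]

variable (k A V) in
/-- The map `μ ⊗ id_V : A ⊗ A ⊗ V → A ⊗ V`. -/
def mulId : A ⊗[k] (A ⊗[k] V) →ₗ[k] A ⊗[k] V :=
  (LinearMap.mul' k A).rTensor V ∘ₗ (TensorProduct.assoc k A A V).symm.toLinearMap

/-- For `τ : V ⊗ W → A ⊗ V`, the map
`(μ ⊗ id_V) ∘ (id_A ⊗ τ) : A ⊗ V ⊗ W → A ⊗ V`. It is used for `τ = σ`, `W = V`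
and for `τ = R`, `W = A`. -/
def extLeft {W : Type*} [AddCommGroup W] [Module k W] (τ : V ⊗[k] W →ₗ[k] A ⊗[k] V) :
    (A ⊗[k] V) ⊗[k] W →ₗ[k] A ⊗[k] V :=
  mulId k A V ∘ₗ τ.lTensor A ∘ₗ (TensorProduct.assoc k A V W).toLinearMap

/-- For `g : V → A ⊗ V`, the map `(μ ⊗ id_V) ∘ (id_A ⊗ g) : A ⊗ V → A ⊗ V`. -/
def extOne (g : V →ₗ[k] A ⊗[k] V) : A ⊗[k] V →ₗ[k] A ⊗[k] V :=
  mulId k A V ∘ₗ g.lTensor A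

/-- The conditions on `R : V ⊗ A → A ⊗ V`, `σ : V ⊗ V → A ⊗ V` and the distinguished element
`one = 1_V` of `V` under which `A ⊗_{R,σ} V` is a crossed product. -/
structure IsCrossed (one : V) (R : V ⊗[k] A →ₗ[k] A ⊗[k] V)
    (σ : V ⊗[k] V →ₗ[k] A ⊗[k] V) : Prop where
  R_one_left : ∀ a : A, R (one ⊗ₜ a) = a ⊗ₜ one
  R_one_right : ∀ v : V, R (v ⊗ₜ 1) = 1 ⊗ₜ v
  σ_one_left : ∀ v : V, σ (one ⊗ₜ v) = 1 ⊗ₜ v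
  σ_one_right : ∀ v : V, σ (v ⊗ₜ one) = 1 ⊗ₜ v
  /-- `R ∘ (id ⊗ μ) = (μ ⊗ id) ∘ (id ⊗ R) ∘ (R ⊗ id)` -/
  R_mul : R ∘ₗ (LinearMap.mul' k A).lTensor V =
    extLeft R ∘ₗ R.rTensor A ∘ₗ (TensorProduct.assoc k V A A).symm.toLinearMap
  /-- `(μ ⊗ id) ∘ (id ⊗ σ) ∘ (R ⊗ id) ∘ (id ⊗ σ) = (μ ⊗ id) ∘ (id ⊗ σ) ∘ (σ ⊗ id)` -/
  cocycle : extLeft σ ∘ₗ R.rTensor V ∘ₗ (TensorProduct.assoc k V A V).symm.toLinearMap ∘ₗ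
      σ.lTensor V =
    extLeft σ ∘ₗ σ.rTensor V ∘ₗ (TensorProduct.assoc k V V V).symm.toLinearMap
  /-- `(μ ⊗ id) ∘ (id ⊗ σ) ∘ (R ⊗ id) ∘ (id ⊗ R) = (μ ⊗ id) ∘ (id ⊗ R) ∘ (σ ⊗ id)` -/
  twisted : extLeft σ ∘ₗ R.rTensor V ∘ₗ (TensorProduct.assoc k V A V).symm.toLinearMap ∘ₗ
      R.lTensor V =
    extLeft R ∘ₗ σ.rTensor A ∘ₗ (TensorProduct.assoc k V V A).symm.toLinearMap

/-- The multiplication `(μ₂ ⊗ id_V) ∘ (id_A ⊗ id_A ⊗ σ) ∘ (id_A ⊗ R ⊗ id_V)` on `A ⊗ V`, where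
`μ₂ = μ ∘ (id_A ⊗ μ)`. -/
def crossedMul (R : V ⊗[k] A →ₗ[k] A ⊗[k] V) (σ : V ⊗[k] V →ₗ[k] A ⊗[k] V) :
    (A ⊗[k] V) ⊗[k] (A ⊗[k] V) →ₗ[k] A ⊗[k] V :=
  mulId k A V ∘ₗ
    (extLeft σ ∘ₗ R.rTensor V ∘ₗ (TensorProduct.assoc k V A V).symm.toLinearMap).lTensor A ∘ₗ
    (TensorProduct.assoc k A V (A ⊗[k] V)).toLinearMap

/-! #### The algebra structure -/

@[simp] lemma mulId_tmul (a b : A) (v : V) :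
    mulId k A V (a ⊗ₜ (b ⊗ₜ v)) = (a * b) ⊗ₜ v := by
  simp [mulId]

lemma mulId_one (x : A ⊗[k] V) : mulId k A V (1 ⊗ₜ x) = x := by
  induction x with
  | zero => simp
  | tmul a v => simp
  | add x y hx hy => rw [TensorProduct.tmul_add, map_add, hx, hy]

lemma mulId_mul (a b : A) (x : A ⊗[k] V) :
    mulId k A V ((a * b) ⊗ₜ x) = mulId k A V (a ⊗ₜ mulId k A V (b ⊗ₜ x)) := by
  induction x with
  | zero => simp
  | tmul c v => simp [mul_assoc]
  | add x y hx hy => simp only [TensorProduct.tmul_add, map_add, hx, hy]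

@[simp] lemma ext_tmul {W : Type*} [AddCommGroup W] [Module k W]
    (τ : V ⊗[k] W →ₗ[k] A ⊗[k] V) (a : A) (v : V) (w : W) :
    extLeft τ ((a ⊗ₜ v) ⊗ₜ w) = mulId k A V (a ⊗ₜ τ (v ⊗ₜ w)) := by
  simp [extLeft]

lemma ext_mulId {W : Type*} [AddCommGroup W] [Module k W]
    (τ : V ⊗[k] W →ₗ[k] A ⊗[k] V) (a : A) (x : A ⊗[k] V) (w : W) :
    extLeft τ (mulId k A V (a ⊗ₜ x) ⊗ₜ w) = mulId k A V (a ⊗ₜ extLeft τ (x ⊗ₜ w)) := by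
  induction x with
  | zero => simp
  | tmul b v => simp [mulId_mul]
  | add x y hx hy => simp only [TensorProduct.tmul_add, TensorProduct.add_tmul, map_add, hx, hy]

lemma crossedMul_tmul (R : V ⊗[k] A →ₗ[k] A ⊗[k] V) (σ : V ⊗[k] V →ₗ[k] A ⊗[k] V)
    (a b : A) (v w : V) :
    crossedMul R σ ((a ⊗ₜ v) ⊗ₜ (b ⊗ₜ w)) =
      mulId k A V (a ⊗ₜ extLeft σ (R (v ⊗ₜ b) ⊗ₜ w)) := by
  simp [crossedMul]

lemma crossedMul_mulId (R : V ⊗[k] A →ₗ[k] A ⊗[k] V) (σ : V ⊗[k] V →ₗ[k] A ⊗[k] V)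
    (a : A) (x y : A ⊗[k] V) :
    crossedMul R σ (mulId k A V (a ⊗ₜ x) ⊗ₜ y) =
      mulId k A V (a ⊗ₜ crossedMul R σ (x ⊗ₜ y)) := by
  induction x with
  | zero => simp
  | add x x' hx hx' => simp only [TensorProduct.tmul_add, TensorProduct.add_tmul, map_add, hx, hx']
  | tmul b v =>
    induction y with
    | zero => simp
    | add y y' hy hy' => simp only [TensorProduct.tmul_add, map_add, hy, hy']
    | tmul c w => simp [crossedMul_tmul, mulId_mul]

namespace IsCrossed

variable {one : V} {R : V ⊗[k] A →ₗ[k] A ⊗[k] V} {σ : V ⊗[k] V →ₗ[k] A ⊗[k] V}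

lemma R_mul_apply (h : IsCrossed one R σ) (v : V) (a b : A) :
    R (v ⊗ₜ (a * b)) = extLeft R (R (v ⊗ₜ a) ⊗ₜ b) := by
  simpa using LinearMap.congr_fun h.R_mul (v ⊗ₜ (a ⊗ₜ b))

/-- In `A ⊗_{R,σ} V` one has `x * (b y) = (x ◁ b) * y`, where `x ◁ b` is obtained from `R`. -/
lemma crossedMul_mulId_right (h : IsCrossed one R σ) (x y : A ⊗[k] V) (b : A) :
    crossedMul R σ (x ⊗ₜ mulId k A V (b ⊗ₜ y)) =
      crossedMul R σ (extLeft R (x ⊗ₜ b) ⊗ₜ y) := by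
  induction x with
  | zero => simp
  | add x x' hx hx' => simp only [TensorProduct.add_tmul, map_add, hx, hx']
  | tmul a v =>
    induction y with
    | zero => simp
    | add y y' hy hy' => simp only [TensorProduct.tmul_add, map_add, hy, hy']
    | tmul c w =>
      rw [mulId_tmul, crossedMul_tmul, h.R_mul_apply, ext_tmul, crossedMul_mulId]
      generalize R (v ⊗ₜ b) = z
      congr 2
      induction z with
      | zero => simp
      | add z z' hz hz' => simp only [TensorProduct.add_tmul, map_add, hz, hz']
      | tmul d u => simp [crossedMul_tmul, ext_mulId]

lemma crossedMul_one_tmul (h : IsCrossed one R σ) (x : A ⊗[k] V) (w : V) :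
    crossedMul R σ (x ⊗ₜ (1 ⊗ₜ w)) = extLeft σ (x ⊗ₜ w) := by
  induction x with
  | zero => simp
  | add x x' hx hx' => simp only [TensorProduct.add_tmul, map_add, hx, hx']
  | tmul a v => simp [crossedMul_tmul, h.R_one_right, mulId_one]

lemma crossedMul_ext (h : IsCrossed one R σ) (x z : A ⊗[k] V) (u : V) :
    crossedMul R σ (x ⊗ₜ extLeft σ (z ⊗ₜ u)) = extLeft σ (crossedMul R σ (x ⊗ₜ z) ⊗ₜ u) := by
  have key : ∀ (v w u : V),
      crossedMul R σ ((1 ⊗ₜ v) ⊗ₜ σ (w ⊗ₜ u)) = extLeft σ (σ (v ⊗ₜ w) ⊗ₜ u) := by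
    intro v w u
    have := LinearMap.congr_fun h.cocycle (v ⊗ₜ (w ⊗ₜ u))
    simpa [crossedMul, mulId_one] using this
  induction z with
  | zero => simp
  | add z z' hz hz' => simp only [TensorProduct.add_tmul, TensorProduct.tmul_add, map_add, hz, hz']
  | tmul c w =>
    rw [ext_tmul, h.crossedMul_mulId_right]
    have : crossedMul R σ (x ⊗ₜ[k] (c ⊗ₜ[k] w)) =
        crossedMul R σ (extLeft R (x ⊗ₜ c) ⊗ₜ (1 ⊗ₜ w)) := by
      rw [← h.crossedMul_mulId_right, mulId_tmul, mul_one]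
    rw [this, h.crossedMul_one_tmul]
    generalize extLeft R (x ⊗ₜ c) = y
    induction y with
    | zero => simp
    | add y y' hy hy' => simp only [TensorProduct.add_tmul, map_add, hy, hy']
    | tmul d v =>
      have h1 : (d ⊗ₜ[k] v : A ⊗[k] V) = mulId k A V (d ⊗ₜ (1 ⊗ₜ v)) := by simp
      rw [ext_tmul, ext_mulId, h1, crossedMul_mulId, key]

lemma ext_R_crossedMul (h : IsCrossed one R σ) (v w : V) (c : A) :
    extLeft R (σ (v ⊗ₜ w) ⊗ₜ c) = crossedMul R σ ((1 ⊗ₜ v) ⊗ₜ R (w ⊗ₜ c)) := by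
  have := LinearMap.congr_fun h.twisted (v ⊗ₜ (w ⊗ₜ c))
  simpa [crossedMul, mulId_one] using this.symm

lemma mul_assoc' (h : IsCrossed one R σ) (x y z : A ⊗[k] V) :
    crossedMul R σ (crossedMul R σ (x ⊗ₜ y) ⊗ₜ z) =
      crossedMul R σ (x ⊗ₜ crossedMul R σ (y ⊗ₜ z)) := by
  have key : ∀ (p : A ⊗[k] V) (w u : V) (c : A),
      crossedMul R σ (extLeft σ (p ⊗ₜ w) ⊗ₜ (c ⊗ₜ u)) =
        crossedMul R σ (p ⊗ₜ extLeft σ (R (w ⊗ₜ c) ⊗ₜ u)) := by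
    intro p w u c
    induction p with
    | zero => simp
    | add p p' hp hp' => simp only [TensorProduct.add_tmul, map_add, hp, hp']
    | tmul d v =>
      have h1 : (d ⊗ₜ[k] v : A ⊗[k] V) = mulId k A V (d ⊗ₜ (1 ⊗ₜ v)) := by simp
      have h2 : (c ⊗ₜ[k] u : A ⊗[k] V) = mulId k A V (c ⊗ₜ (1 ⊗ₜ u)) := by simp
      rw [ext_tmul, crossedMul_mulId, h1, crossedMul_mulId, h2, h.crossedMul_mulId_right,
        h.crossedMul_one_tmul, h.ext_R_crossedMul, h.crossedMul_ext]
  induction y with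
  | zero => simp
  | add y y' hy hy' => simp only [TensorProduct.add_tmul, TensorProduct.tmul_add, map_add, hy, hy']
  | tmul b w =>
    induction z with
    | zero => simp
    | add z z' hz hz' => simp only [TensorProduct.tmul_add, map_add, hz, hz']
    | tmul c u =>
      have h1 : (b ⊗ₜ[k] w : A ⊗[k] V) = mulId k A V (b ⊗ₜ (1 ⊗ₜ w)) := by simp
      rw [crossedMul_tmul, h.crossedMul_mulId_right, h1, h.crossedMul_mulId_right,
        h.crossedMul_one_tmul, key]

lemma one_mul' (h : IsCrossed one R σ) (x : A ⊗[k] V) :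
    crossedMul R σ ((1 ⊗ₜ one) ⊗ₜ x) = x := by
  induction x with
  | zero => simp
  | add x y hx hy => simp only [TensorProduct.tmul_add, map_add, hx, hy]
  | tmul a v => simp [crossedMul_tmul, h.R_one_left, h.σ_one_left]

lemma mul_one' (h : IsCrossed one R σ) (x : A ⊗[k] V) :
    crossedMul R σ (x ⊗ₜ (1 ⊗ₜ one)) = x := by
  induction x with
  | zero => simp
  | add x y hx hy => simp only [TensorProduct.add_tmul, map_add, hx, hy]
  | tmul a v => simp [crossedMul_tmul, h.R_one_right, h.σ_one_right]

end IsCrossed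

/-- The crossed product `A ⊗_{R,σ} V`: the vector space `A ⊗ V`, with the multiplication
`crossedMul R σ` and the unit `1_A ⊗ 1_V`. -/
def CrossedProduct {one : V} {R : V ⊗[k] A →ₗ[k] A ⊗[k] V} {σ : V ⊗[k] V →ₗ[k] A ⊗[k] V}
    (_ : IsCrossed one R σ) : Type _ :=
  A ⊗[k] V

namespace CrossedProduct

variable {one : V} {R : V ⊗[k] A →ₗ[k] A ⊗[k] V} {σ : V ⊗[k] V →ₗ[k] A ⊗[k] V}

instance (h : IsCrossed one R σ) : AddCommGroup (CrossedProduct h) :=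
  inferInstanceAs (AddCommGroup (A ⊗[k] V))

instance (h : IsCrossed one R σ) : Module k (CrossedProduct h) :=
  inferInstanceAs (Module k (A ⊗[k] V))

/-- The identity map from the vector space `A ⊗ V` to `A ⊗_{R,σ} V`. -/
def of (h : IsCrossed one R σ) : A ⊗[k] V ≃ₗ[k] CrossedProduct h :=
  LinearEquiv.refl k (A ⊗[k] V)

instance (h : IsCrossed one R σ) : Ring (CrossedProduct h) :=
  { (inferInstance : AddCommGroup (CrossedProduct h)) with
    mul := fun x y => of h (crossedMul R σ ((of h).symm x ⊗ₜ (of h).symm y))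
    one := of h (1 ⊗ₜ one)
    mul_assoc := fun x y z => h.mul_assoc' x y z
    one_mul := fun x => h.one_mul' x
    mul_one := fun x => h.mul_one' x
    left_distrib := fun x y z =>
      (congrArg (crossedMul R σ) (TensorProduct.tmul_add (R := k) (M := A ⊗[k] V)
        (N := A ⊗[k] V) x y z)).trans (map_add (crossedMul R σ) _ _)
    right_distrib := fun x y z =>
      (congrArg (crossedMul R σ) (TensorProduct.add_tmul (R := k) (M := A ⊗[k] V)
        (N := A ⊗[k] V) x y z)).trans (map_add (crossedMul R σ) _ _)
    zero_mul := fun x =>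
      (congrArg (crossedMul R σ) (TensorProduct.zero_tmul (R := k) (A ⊗[k] V)
        (n := (x : A ⊗[k] V)))).trans (map_zero (crossedMul R σ))
    mul_zero := fun x =>
      (congrArg (crossedMul R σ) (TensorProduct.tmul_zero (R := k) (A ⊗[k] V)
        (m := (x : A ⊗[k] V)))).trans (map_zero (crossedMul R σ)) }

instance (h : IsCrossed one R σ) : Algebra k (CrossedProduct h) :=
  Algebra.ofModule
    (fun r x y =>
      (congrArg (crossedMul R σ) (TensorProduct.smul_tmul' (R := k) (M := A ⊗[k] V)
        (N := A ⊗[k] V) r x y).symm).trans (map_smul (crossedMul R σ) r _))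
    (fun r x y =>
      (congrArg (crossedMul R σ) (TensorProduct.tmul_smul (R := k) (M := A ⊗[k] V)
        (N := A ⊗[k] V) r x y)).trans (map_smul (crossedMul R σ) r _))

end CrossedProduct

/-! #### The data of the invariance under twisting theorem -/

/-- `R' = (μ₂ ⊗ id_V) ∘ (id_A ⊗ id_A ⊗ γ) ∘ (id_A ⊗ R) ∘ (θ ⊗ id_A)`. -/
def twistR (R : V ⊗[k] A →ₗ[k] A ⊗[k] V) (θ γ : V →ₗ[k] A ⊗[k] V) :
    V ⊗[k] A →ₗ[k] A ⊗[k] V :=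
  mulId k A V ∘ₗ (extOne γ).lTensor A ∘ₗ R.lTensor A ∘ₗ
    (TensorProduct.assoc k A V A).toLinearMap ∘ₗ θ.rTensor A

/-- `σ' = (μ ⊗ id_V) ∘ (id_A ⊗ γ) ∘ (μ₂ ⊗ id_V) ∘ (id_A ⊗ id_A ⊗ σ) ∘ (id_A ⊗ R ⊗ id_V)
  ∘ (θ ⊗ θ)`. -/
def twistSigma (R : V ⊗[k] A →ₗ[k] A ⊗[k] V) (σ : V ⊗[k] V →ₗ[k] A ⊗[k] V)
    (θ γ : V →ₗ[k] A ⊗[k] V) : V ⊗[k] V →ₗ[k] A ⊗[k] V :=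
  extOne γ ∘ₗ crossedMul R σ ∘ₗ TensorProduct.map θ θ

/-- The hypotheses on `θ` and `γ` in the invariance under twisting theorem for the crossed
product `A ⊗_{R,σ} V`. -/
structure TwistConditions (one : V) (R : V ⊗[k] A →ₗ[k] A ⊗[k] V)
    (σ : V ⊗[k] V →ₗ[k] A ⊗[k] V) (θ γ : V →ₗ[k] A ⊗[k] V) : Prop where
  θ_one : θ one = 1 ⊗ₜ one
  γ_one : γ one = 1 ⊗ₜ one
  /-- `v_{<-1>} v_{<0>{-1}} ⊗ v_{<0>{0}} = 1 ⊗ v` -/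
  γ_θ : ∀ v : V, extOne γ (θ v) = 1 ⊗ₜ v
  /-- `v_{{-1}} v_{{0}<-1>} ⊗ v_{{0}<0>} = 1 ⊗ v` -/
  θ_γ : ∀ v : V, extOne θ (γ v) = 1 ⊗ₜ v
  /-- `(μ ⊗ id) ∘ (μ ⊗ σ') ∘ (id ⊗ γ ⊗ id) ∘ (R ⊗ id) ∘ (id ⊗ γ) = (μ ⊗ id) ∘ (id ⊗ γ) ∘ σ` -/
  γ_σ : mulId k A V ∘ₗ
      TensorProduct.map (LinearMap.mul' k A) (twistSigma R σ θ γ) ∘ₗ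
      (TensorProduct.assoc k (A ⊗[k] A) V V).toLinearMap ∘ₗ
      (TensorProduct.assoc k A A V).symm.toLinearMap.rTensor V ∘ₗ
      (γ.lTensor A).rTensor V ∘ₗ R.rTensor V ∘ₗ
      (TensorProduct.assoc k V A V).symm.toLinearMap ∘ₗ γ.lTensor V =
    extOne γ ∘ₗ σ

end General

/-! ### Entwining data and crossed products by a coalgebra -/

open Coalgebra

/-- Entwining data `(P, C, Ψ, e, Ψ^C)`: an entwining structure `Ψ : C ⊗ P → P ⊗ C` between an
algebra `P` and a coalgebra `C`, a group-like element `e` of `C` and a map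
`Ψ^C : C ⊗ C → C ⊗ C` that is compatible with the coalgebra structure as `Ψ` is and satisfies
`Ψ^C (e ⊗ c) = Δ c`. -/
structure EntwiningData (k P C : Type*) [Field k] [Ring P] [Algebra k P] [AddCommGroup C]
    [Module k C] [Coalgebra k C] where
  /-- the entwining map `Ψ` -/
  Ψ : C ⊗[k] P →ₗ[k] P ⊗[k] C
  /-- the group-like element -/
  e : C
  /-- the map `Ψ^C` -/
  ΨC : C ⊗[k] C →ₗ[k] C ⊗[k] C
  /-- `Ψ ∘ (id ⊗ μ) = (μ ⊗ id) ∘ Ψ₂₃ ∘ Ψ₁₂` -/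
  Ψ_mul : Ψ ∘ₗ (LinearMap.mul' k P).lTensor C =
    (LinearMap.mul' k P).rTensor C ∘ₗ (TensorProduct.assoc k P P C).symm.toLinearMap ∘ₗ
      Ψ.lTensor P ∘ₗ (TensorProduct.assoc k P C P).toLinearMap ∘ₗ Ψ.rTensor P ∘ₗ
      (TensorProduct.assoc k C P P).symm.toLinearMap
  Ψ_one : ∀ c : C, Ψ (c ⊗ₜ 1) = 1 ⊗ₜ c
  /-- `(id ⊗ Δ) ∘ Ψ = Ψ₁₂ ∘ Ψ₂₃ ∘ (Δ ⊗ id)` -/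
  Ψ_comul : (comul (R := k) (A := C)).lTensor P ∘ₗ Ψ =
    (TensorProduct.assoc k P C C).toLinearMap ∘ₗ Ψ.rTensor C ∘ₗ
      (TensorProduct.assoc k C P C).symm.toLinearMap ∘ₗ Ψ.lTensor C ∘ₗ
      (TensorProduct.assoc k C C P).toLinearMap ∘ₗ (comul (R := k) (A := C)).rTensor P
  /-- `(id ⊗ ε) ∘ Ψ = ε ⊗ id` -/
  Ψ_counit : (TensorProduct.rid k P).toLinearMap ∘ₗ (counit (R := k) (A := C)).lTensor P ∘ₗ Ψ =
    (TensorProduct.lid k P).toLinearMap ∘ₗ (counit (R := k) (A := C)).rTensor P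
  groupLike : IsGroupLikeElem k e
  /-- `(id ⊗ Δ) ∘ Ψ^C = Ψ^C₁₂ ∘ Ψ^C₂₃ ∘ (Δ ⊗ id)` -/
  ΨC_comul : (comul (R := k) (A := C)).lTensor C ∘ₗ ΨC =
    (TensorProduct.assoc k C C C).toLinearMap ∘ₗ ΨC.rTensor C ∘ₗ
      (TensorProduct.assoc k C C C).symm.toLinearMap ∘ₗ ΨC.lTensor C ∘ₗ
      (TensorProduct.assoc k C C C).toLinearMap ∘ₗ (comul (R := k) (A := C)).rTensor C
  /-- `(id ⊗ ε) ∘ Ψ^C = ε ⊗ id` -/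
  ΨC_counit : (TensorProduct.rid k C).toLinearMap ∘ₗ (counit (R := k) (A := C)).lTensor C ∘ₗ ΨC =
    (TensorProduct.lid k C).toLinearMap ∘ₗ (counit (R := k) (A := C)).rTensor C
  ΨC_e : ∀ c : C, ΨC (e ⊗ₜ c) = comul (R := k) c

namespace EntwiningData

variable {k P C : Type*} [Field k] [Ring P] [Algebra k P] [AddCommGroup C]
    [Module k C] [Coalgebra k C] (E : EntwiningData k P C)

lemma Ψ_mul_apply (c : C) (a b : P) :
    E.Ψ (c ⊗ₜ (a * b)) = (LinearMap.mul' k P).rTensor C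
      ((TensorProduct.assoc k P P C).symm (E.Ψ.lTensor P
        (TensorProduct.assoc k P C P (E.Ψ (c ⊗ₜ a) ⊗ₜ b)))) := by
  simpa using LinearMap.congr_fun E.Ψ_mul (c ⊗ₜ (a ⊗ₜ b))

/-- The subalgebra `A = P_e^{co C} = {u ∈ P | Ψ (e ⊗ u) = u ⊗ e}` of coinvariants. -/
def coinv : Subalgebra k P where
  carrier := {u | E.Ψ (E.e ⊗ₜ u) = u ⊗ₜ E.e}
  mul_mem' := by
    intro a b ha hb
    simp only [Set.mem_ofPred_eq] at ha hb ⊢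
    rw [E.Ψ_mul_apply, ha]
    simp [hb]
  add_mem' := by
    intro a b ha hb
    simp only [Set.mem_ofPred_eq] at ha hb ⊢
    rw [TensorProduct.tmul_add, map_add, ha, hb, TensorProduct.add_tmul]
  algebraMap_mem' := by
    intro r
    simp only [Set.mem_ofPred_eq]
    rw [Algebra.algebraMap_eq_smul_one, TensorProduct.tmul_smul, map_smul, E.Ψ_one,
      TensorProduct.smul_tmul']

/-- The inclusion `A → P`. -/
def incl : E.coinv →ₗ[k] P := E.coinv.val.toLinearMap

/-- The inclusion `A ⊗ C → P ⊗ C`. -/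
def inclC : E.coinv ⊗[k] C →ₗ[k] P ⊗[k] C := E.incl.rTensor C

lemma inclC_injective : Function.Injective E.inclC :=
  Module.Flat.rTensor_preserves_injective_linearMap E.incl Subtype.val_injective

/-- The map `(F ⊗ id_C) ∘ (id_C ⊗ Ψ) ∘ (Δ ⊗ id_A) : C ⊗ A → P ⊗ C`. -/
def preR (F : C ⊗[k] P →ₗ[k] P) : C ⊗[k] E.coinv →ₗ[k] P ⊗[k] C :=
  F.rTensor C ∘ₗ (TensorProduct.assoc k C P C).symm.toLinearMap ∘ₗ E.Ψ.lTensor C ∘ₗ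
    (TensorProduct.assoc k C C P).toLinearMap ∘ₗ
    TensorProduct.map (comul (R := k) (A := C)) E.incl

/-- `(F ⊗ id_C) ∘ (id_C ⊗ Ψ) ∘ (Δ ⊗ id_A)` takes its values in `A ⊗ C`. -/
def MapsCoinv (F : C ⊗[k] P →ₗ[k] P) : Prop :=
  ∀ x, E.preR F x ∈ LinearMap.range E.inclC

/-- `R_F = (F ⊗ id_C) ∘ (id_C ⊗ Ψ) ∘ (Δ ⊗ id_A)`, as a map `C ⊗ A → A ⊗ C`. -/
def RF (F : C ⊗[k] P →ₗ[k] P) (hF : E.MapsCoinv F) : C ⊗[k] E.coinv →ₗ[k] E.coinv ⊗[k] C :=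
  LinearMap.codRestrictOfInjective (E.preR F) E.inclC E.inclC_injective hF

/-- `σ_f = (f ⊗ id_C) ∘ (id_C ⊗ Ψ^C) ∘ (Δ ⊗ id_C)`. -/
def sigmaF (f : C ⊗[k] C →ₗ[k] E.coinv) : C ⊗[k] C →ₗ[k] E.coinv ⊗[k] C :=
  f.rTensor C ∘ₗ (TensorProduct.assoc k C C C).symm.toLinearMap ∘ₗ E.ΨC.lTensor C ∘ₗ
    (TensorProduct.assoc k C C C).toLinearMap ∘ₗ (comul (R := k) (A := C)).rTensor C

/-- `F` and `f` define a crossed product by a coalgebra: `R_F` is a map `C ⊗ A → A ⊗ C` and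
`A ⊗_{R_F,σ_f} C` is a crossed product. -/
structure IsCoalgCrossed (F : C ⊗[k] P →ₗ[k] P) (f : C ⊗[k] C →ₗ[k] E.coinv) : Prop where
  mapsCoinv : E.MapsCoinv F
  isCrossed : IsCrossed E.e (E.RF F mapsCoinv) (E.sigmaF f)

variable {E} in
/-- The crossed product by a coalgebra `A ⋊_{F,f} C = A ⊗_{R_F,σ_f} C`. -/
abbrev CoalgCrossedProduct {F : C ⊗[k] P →ₗ[k] P} {f : C ⊗[k] C →ₗ[k] E.coinv}
    (h : E.IsCoalgCrossed F f) : Type _ :=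
  CrossedProduct h.isCrossed

/-- The map `c ↦ ν(c₁) ⊗ c₂`. -/
def coact (ν : C →ₗ[k] E.coinv) : C →ₗ[k] E.coinv ⊗[k] C :=
  ν.rTensor C ∘ₗ comul (R := k) (A := C)

/-- `Ψ^C₂₃ ∘ Ψ₁₂ ∘ (id ⊗ ν ⊗ id) ∘ (id ⊗ Δ) = (ν ⊗ id ⊗ id) ∘ (Δ ⊗ id) ∘ Ψ^C`, as maps
`C ⊗ C → P ⊗ C ⊗ C`. -/
def Compatible (ν : C →ₗ[k] E.coinv) : Prop :=
  E.ΨC.lTensor P ∘ₗ (TensorProduct.assoc k P C C).toLinearMap ∘ₗ E.Ψ.rTensor C ∘ₗ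
      (TensorProduct.assoc k C P C).symm.toLinearMap ∘ₗ
      ((E.incl ∘ₗ ν).rTensor C).lTensor C ∘ₗ (comul (R := k) (A := C)).lTensor C =
    (E.incl ∘ₗ ν).rTensor (C ⊗[k] C) ∘ₗ (TensorProduct.assoc k C C C).toLinearMap ∘ₗ
      (comul (R := k) (A := C)).rTensor C ∘ₗ E.ΨC

/-- `F_ν(c ⊗ u) = ν(c₁) F(c₂ ⊗ u_α) ν⁻¹(c₃^α)`, where `Ψ(c ⊗ u) = u_α ⊗ c^α`; the argument `ν'`
stands for the convolution inverse of `ν`. -/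
def twistF (F : C ⊗[k] P →ₗ[k] P) (ν ν' : C →ₗ[k] E.coinv) : C ⊗[k] P →ₗ[k] P :=
  LinearMap.mul' k P ∘ₗ
    TensorProduct.map (E.incl ∘ₗ ν)
      (LinearMap.mul' k P ∘ₗ TensorProduct.map F (E.incl ∘ₗ ν') ∘ₗ
        (TensorProduct.assoc k C P C).symm.toLinearMap ∘ₗ E.Ψ.lTensor C ∘ₗ
        (TensorProduct.assoc k C C P).toLinearMap ∘ₗ (comul (R := k) (A := C)).rTensor P) ∘ₗ
    (TensorProduct.assoc k C C P).toLinearMap ∘ₗ (comul (R := k) (A := C)).rTensor P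

/-- `f_ν(c ⊗ d) = ν(c₁) F(c₂ ⊗ ν(d₁)_α) f(c₃^α₁ ⊗ d₂_β) ν⁻¹(c₃^α₂^β)`, where
`Ψ(c ⊗ u) = u_α ⊗ c^α` and `Ψ^C(c ⊗ d) = d_β ⊗ c^β`. The factors in the middle are grouped as
`R_F(c₂ ⊗ ν(d₁)) = F(c₂ ⊗ ν(d₁)_α) ⊗ c₃^α` and `σ_f(x ⊗ d₂) = f(x₁ ⊗ d₂_β) ⊗ x₂^β`, which
shows that the values are in `A`. The argument `ν'` stands for the convolution inverse of `ν`. -/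
def twistCocycle (F : C ⊗[k] P →ₗ[k] P) (hF : E.MapsCoinv F) (f : C ⊗[k] C →ₗ[k] E.coinv)
    (ν ν' : C →ₗ[k] E.coinv) : C ⊗[k] C →ₗ[k] E.coinv :=
  LinearMap.mul' k E.coinv ∘ₗ
    TensorProduct.map ν
      (LinearMap.mul' k E.coinv ∘ₗ
        (LinearMap.mul' k E.coinv ∘ₗ ν'.lTensor E.coinv ∘ₗ E.sigmaF f).lTensor E.coinv ∘ₗ
        (TensorProduct.assoc k E.coinv C C).toLinearMap ∘ₗ
        (E.RF F hF).rTensor C ∘ₗ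
        (TensorProduct.assoc k C E.coinv C).symm.toLinearMap ∘ₗ
        (E.coact ν).lTensor C) ∘ₗ
    (TensorProduct.assoc k C C C).toLinearMap ∘ₗ (comul (R := k) (A := C)).rTensor C

end EntwiningData

end CrossedProd

end

noncomputable section

namespace CrossedProd

open Coalgebra

/-! ### Invariance under twisting for a general crossed product. -/

section Twist

variable {k A V : Type*} [Field k] [Ring A] [Algebra k A] [AddCommGroup V] [Module k V]

/-! The maps `θ` and `γ` extend to left `A`-linear endomorphisms `extOne θ`, `extOne γ` of `A ⊗ V`,
and being inverse to each other is a condition on generators `1 ⊗ v` only. The maps `R'` and `σ'`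
are designed so that the product they define is the old product transported along the bijection
`extOne θ` (`IsCrossed.crossedMul_twist`). Each crossed product axiom for `R'`, `σ'` is then a unit
law or an instance of associativity in `A ⊗_{R,σ} V`, and `extOne θ` is the isomorphism. The
remaining twisting condition, on `γ` and `σ`, follows from the same cancellation of `θ` against `γ`.

For a coalgebra, one construction underlies both structure maps: `coext T G` sends `c ⊗ x` to `G(c₁
⊗ x_α) ⊗ c₂^α`, where `T(c ⊗ x) = x_α ⊗ c^α`. Up to the inclusion of `A` in `P`, `R_F` is `coext Ψ
F`, while `σ_f` is `coext Ψ^C f`. To see that twisting `F` and `f` twists `R_F` and `σ_f`, it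
suffices to know how `coext` reacts to the operations from which `F_ν` and `f_ν` are built:
multiplication by `ν(c₁)` on the left (`coext_leftTwist`, by coassociativity), multiplication by
`ν⁻¹` on the right (`coext_rightTwist`, by compatibility of `T` with `Δ`), and, for `f_ν`,
composition of two entwinings (`coext_compEntwining`). The compatibility condition on `ν` enters
only for `f_ν`: it says that `d ↦ ν(d₁) ⊗ d₂` intertwines `Ψ^C` with the composite of `Ψ` and `Ψ^C`,
so that `coext` may be computed after this substitution. -/

@[simp] lemma extOne_tmul (g : V →ₗ[k] A ⊗[k] V) (a : A) (v : V) :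
    extOne g (a ⊗ₜ v) = mulId k A V (a ⊗ₜ g v) := by
  simp [extOne]

lemma extOne_mulId (g : V →ₗ[k] A ⊗[k] V) (a : A) (x : A ⊗[k] V) :
    extOne g (mulId k A V (a ⊗ₜ x)) = mulId k A V (a ⊗ₜ extOne g x) := by
  induction x with
  | zero => simp
  | tmul b v => simp [mulId_mul]
  | add x y hx hy => simp only [TensorProduct.tmul_add, map_add, hx, hy]

/-- Both extensions are left `A`-linear, so the identity on `1 ⊗ v` propagates to all of `A ⊗ V`. -/
lemma extOne_extOne {θ γ : V →ₗ[k] A ⊗[k] V} (h : ∀ v, extOne γ (θ v) = 1 ⊗ₜ v)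
    (x : A ⊗[k] V) : extOne γ (extOne θ x) = x := by
  induction x with
  | zero => simp
  | tmul a v => simp [extOne_mulId, h]
  | add x y hx hy => simp only [map_add, hx, hy]

variable {one : V} {R : V ⊗[k] A →ₗ[k] A ⊗[k] V} {σ : V ⊗[k] V →ₗ[k] A ⊗[k] V}
  {θ γ : V →ₗ[k] A ⊗[k] V}

/-- Expressing `R` through the product by elements `a ⊗ 1_V` lets the axioms involving `R` be read
as associativity. -/
lemma IsCrossed.extLeft_R (h : IsCrossed one R σ) (x : A ⊗[k] V) (a : A) :
    extLeft R (x ⊗ₜ a) = crossedMul R σ (x ⊗ₜ (a ⊗ₜ one)) := by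
  rw [← h.mul_one' (extLeft R (x ⊗ₜ a)), ← h.crossedMul_mulId_right, mulId_tmul, mul_one]

lemma twistR_tmul (v : V) (a : A) :
    twistR R θ γ (v ⊗ₜ a) = extOne γ (extLeft R (θ v ⊗ₜ a)) := by
  simp only [twistR, LinearMap.comp_apply, LinearMap.rTensor_tmul]
  generalize θ v = x
  induction x with
  | zero => simp
  | tmul b v => simp [extOne_mulId]
  | add x y hx hy => simp only [TensorProduct.add_tmul, map_add, hx, hy]

lemma twistSigma_tmul (v w : V) :
    twistSigma R σ θ γ (v ⊗ₜ w) = extOne γ (crossedMul R σ (θ v ⊗ₜ θ w)) := by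
  simp [twistSigma]

/-- Transport in its first form: the extension of `R'` is that of `R` conjugated by `extOne θ` and
`extOne γ`. -/
lemma extLeft_twistR (x : A ⊗[k] V) (a : A) :
    extLeft (twistR R θ γ) (x ⊗ₜ a) = extOne γ (extLeft R (extOne θ x ⊗ₜ a)) := by
  induction x with
  | zero => simp
  | tmul b v => simp [twistR_tmul, extOne_mulId, ext_mulId]
  | add x y hx hy => simp only [TensorProduct.add_tmul, map_add, hx, hy]

lemma extLeft_twistSigma (x : A ⊗[k] V) (w : V) :
    extLeft (twistSigma R σ θ γ) (x ⊗ₜ w) =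
      extOne γ (crossedMul R σ (extOne θ x ⊗ₜ θ w)) := by
  induction x with
  | zero => simp
  | tmul b v => simp [twistSigma_tmul, extOne_mulId, crossedMul_mulId]
  | add x y hx hy => simp only [TensorProduct.add_tmul, map_add, hx, hy]

/-- The multiplication of the twisted crossed product is transported along `extOne θ`. -/
lemma IsCrossed.crossedMul_twist (h : IsCrossed one R σ)
    (hθγ : ∀ v, extOne θ (γ v) = 1 ⊗ₜ v) (x y : A ⊗[k] V) :
    crossedMul (twistR R θ γ) (twistSigma R σ θ γ) (x ⊗ₜ y) =
      extOne γ (crossedMul R σ (extOne θ x ⊗ₜ extOne θ y)) := by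
  induction x with
  | zero => simp
  | add x x' hx hx' => simp only [TensorProduct.add_tmul, map_add, hx, hx']
  | tmul a v =>
    induction y with
    | zero => simp
    | add y y' hy hy' => simp only [TensorProduct.tmul_add, map_add, hy, hy']
    | tmul b w =>
      -- The `γ` that ends `R'` cancels against the `θ` that precedes `σ'`. What is left is `θ(v)`
      -- acted on by `b`, times `θ(w)`, which is `θ(v)` times `b θ(w)`.
      rw [crossedMul_tmul, extLeft_twistSigma, twistR_tmul, extOne_extOne hθγ, extOne_tmul,
        extOne_tmul, crossedMul_mulId, h.crossedMul_mulId_right, extOne_mulId]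

lemma IsCrossed.extOne_crossedMul_twist (h : IsCrossed one R σ)
    (hθγ : ∀ v, extOne θ (γ v) = 1 ⊗ₜ v) (x y : A ⊗[k] V) :
    extOne θ (crossedMul (twistR R θ γ) (twistSigma R σ θ γ) (x ⊗ₜ y)) =
      crossedMul R σ (extOne θ x ⊗ₜ extOne θ y) := by
  rw [h.crossedMul_twist hθγ, extOne_extOne hθγ]

lemma crossedMul_one_left (R : V ⊗[k] A →ₗ[k] A ⊗[k] V) (σ : V ⊗[k] V →ₗ[k] A ⊗[k] V)
    (v : V) (y : A ⊗[k] V) :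
    crossedMul R σ ((1 ⊗ₜ v) ⊗ₜ y) =
      extLeft σ (R.rTensor V ((TensorProduct.assoc k V A V).symm (v ⊗ₜ y))) := by
  simp [crossedMul, mulId_one]

/-- Invariance under twisting: `A ⊗_{R',σ'} V` is a crossed product. -/
theorem IsCrossed.twist (h : IsCrossed one R σ) (hθ : θ one = 1 ⊗ₜ one)
    (hγ : γ one = 1 ⊗ₜ one) (hγθ : ∀ v, extOne γ (θ v) = 1 ⊗ₜ v)
    (hθγ : ∀ v, extOne θ (γ v) = 1 ⊗ₜ v) :
    IsCrossed one (twistR R θ γ) (twistSigma R σ θ γ) where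
  R_one_left a := by simp [twistR_tmul, hθ, h.R_one_left, hγ]
  R_one_right v := by rw [twistR_tmul, h.extLeft_R, h.mul_one', hγθ]
  σ_one_left v := by rw [twistSigma_tmul, hθ, h.one_mul', hγθ]
  σ_one_right v := by rw [twistSigma_tmul, hθ, h.mul_one', hγθ]
  R_mul := by
    ext v a b
    simp only [TensorProduct.AlgebraTensorModule.curry_apply, TensorProduct.curry_apply,
      LinearMap.coe_restrictScalars, LinearMap.comp_apply, LinearMap.lTensor_tmul,
      LinearMap.mul'_apply, LinearEquiv.coe_coe, TensorProduct.assoc_symm_tmul,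
      LinearMap.rTensor_tmul]
    -- Associativity for `θ(v)`, `a ⊗ 1_V`, `b ⊗ 1_V`, together with `(a ⊗ 1_V)(b ⊗ 1_V) = ab ⊗
    -- 1_V`.
    rw [extLeft_twistR, twistR_tmul, twistR_tmul, extOne_extOne hθγ]
    simp only [h.extLeft_R]
    rw [h.mul_assoc', crossedMul_tmul, h.R_one_left, ext_tmul, h.σ_one_left, mulId_tmul,
      mulId_tmul, mul_one]
  cocycle := by
    ext v w u
    simp only [TensorProduct.AlgebraTensorModule.curry_apply, TensorProduct.curry_apply,
      LinearMap.coe_restrictScalars, LinearMap.comp_apply, LinearMap.lTensor_tmul,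
      LinearEquiv.coe_coe, TensorProduct.assoc_symm_tmul, LinearMap.rTensor_tmul]
    -- After transport, both sides are `γ` applied to the triple product of `θ(v)`, `θ(w)`, `θ(u)`.
    rw [← crossedMul_one_left, h.crossedMul_twist hθγ, extLeft_twistSigma, twistSigma_tmul,
      twistSigma_tmul, extOne_extOne hθγ, extOne_extOne hθγ, extOne_tmul, mulId_one,
      h.mul_assoc']
  twisted := by
    ext v w a
    simp only [TensorProduct.AlgebraTensorModule.curry_apply, TensorProduct.curry_apply,
      LinearMap.coe_restrictScalars, LinearMap.comp_apply, LinearMap.lTensor_tmul,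
      LinearEquiv.coe_coe, TensorProduct.assoc_symm_tmul, LinearMap.rTensor_tmul]
    -- The same for the triple product of `θ(v)`, `θ(w)` and `a ⊗ 1_V`.
    rw [← crossedMul_one_left, h.crossedMul_twist hθγ, extLeft_twistR, twistSigma_tmul,
      twistR_tmul, extOne_extOne hθγ, extOne_extOne hθγ, extOne_tmul, mulId_one,
      h.extLeft_R, h.extLeft_R, h.mul_assoc']

/-- The last twisting condition is a consequence of the inverse relations: both sides equal `γ`
applied to the product of `1 ⊗ v` and `1 ⊗ w`. -/
theorem IsCrossed.twistConditions (h : IsCrossed one R σ) (hθ : θ one = 1 ⊗ₜ one)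
    (hγ : γ one = 1 ⊗ₜ one) (hγθ : ∀ v, extOne γ (θ v) = 1 ⊗ₜ v)
    (hθγ : ∀ v, extOne θ (γ v) = 1 ⊗ₜ v) :
    TwistConditions one R σ θ γ where
  θ_one := hθ
  γ_one := hγ
  γ_θ := hγθ
  θ_γ := hθγ
  γ_σ := by
    -- Here `γ` is applied to the `V`-factor of `x` and is undone at once by the `θ` hidden in `σ'`.
    have key : ∀ (x : A ⊗[k] V) (w : V), mulId k A V (TensorProduct.map (LinearMap.mul' k A)
        (twistSigma R σ θ γ) (TensorProduct.assoc k (A ⊗[k] A) V V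
          ((TensorProduct.assoc k A A V).symm (γ.lTensor A x) ⊗ₜ w))) =
        extOne γ (crossedMul R σ (x ⊗ₜ θ w)) := by
      intro x w
      induction x with
      | zero => simp
      | add x x' hx hx' => simp only [TensorProduct.add_tmul, map_add, hx, hx']
      | tmul a v =>
        have h1 : ∀ z : A ⊗[k] V, mulId k A V (TensorProduct.map (LinearMap.mul' k A)
            (twistSigma R σ θ γ) (TensorProduct.assoc k (A ⊗[k] A) V V
              ((TensorProduct.assoc k A A V).symm (a ⊗ₜ z) ⊗ₜ w))) =
            mulId k A V (a ⊗ₜ extLeft (twistSigma R σ θ γ) (z ⊗ₜ w)) := by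
          intro z
          induction z with
          | zero => simp
          | add z z' hz hz' =>
            simp only [TensorProduct.add_tmul, TensorProduct.tmul_add, map_add, hz, hz']
          | tmul b u => simp [mulId_mul]
        rw [LinearMap.lTensor_tmul, h1, extLeft_twistSigma, hθγ, ← extOne_mulId,
          ← crossedMul_mulId, mulId_tmul, mul_one]
    ext v w
    have h2 : ∀ z : A ⊗[k] V, mulId k A V (TensorProduct.map (LinearMap.mul' k A)
        (twistSigma R σ θ γ) (TensorProduct.assoc k (A ⊗[k] A) V V
          ((TensorProduct.assoc k A A V).symm.toLinearMap.rTensor V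
            ((γ.lTensor A).rTensor V (R.rTensor V
              ((TensorProduct.assoc k V A V).symm (v ⊗ₜ z))))))) =
        extOne γ (crossedMul R σ ((1 ⊗ₜ v) ⊗ₜ extOne θ z)) := by
      intro z
      induction z with
      | zero => simp
      | add z z' hz hz' => simp only [TensorProduct.tmul_add, map_add, hz, hz']
      | tmul b u =>
        rw [extOne_tmul, h.crossedMul_mulId_right, ext_tmul, mulId_one, ← key]
        simp
    simpa [hθγ, crossedMul_one_left, h.R_one_right, mulId_one] using h2 (γ w)

/-- The isomorphism `A ⊗_{R',σ'} V → A ⊗_{R,σ} V`, `a ⊗ v ↦ a θ(v)`. -/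
def twistEquiv (h : IsCrossed one R σ) {R' : V ⊗[k] A →ₗ[k] A ⊗[k] V}
    {σ' : V ⊗[k] V →ₗ[k] A ⊗[k] V} (h' : IsCrossed one R' σ') (hR : twistR R θ γ = R')
    (hσ : twistSigma R σ θ γ = σ') (hθ : θ one = 1 ⊗ₜ one)
    (hγθ : ∀ v, extOne γ (θ v) = 1 ⊗ₜ v) (hθγ : ∀ v, extOne θ (γ v) = 1 ⊗ₜ v) :
    CrossedProduct h' ≃ₐ[k] CrossedProduct h :=
  AlgEquiv.ofLinearEquiv
    ((CrossedProduct.of h').symm ≪≫ₗ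
      LinearEquiv.ofLinearMap (extOne θ) (extOne γ) (LinearMap.ext (extOne_extOne hθγ))
        (LinearMap.ext (extOne_extOne hγθ)) ≪≫ₗ CrossedProduct.of h)
    (show extOne θ (1 ⊗ₜ one) = 1 ⊗ₜ one by rw [extOne_tmul, hθ, mulId_one])
    -- `R'` and `σ'` are free variables tied to the twisted maps by equations, so the isomorphism
    -- also applies when they are presented in another form, such as `R_{F_ν}` and `σ_{f_ν}`.
    (by subst hR hσ; exact h.extOne_crossedMul_twist hθγ)

lemma twistEquiv_of_tmul (h : IsCrossed one R σ) {R' : V ⊗[k] A →ₗ[k] A ⊗[k] V}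
    {σ' : V ⊗[k] V →ₗ[k] A ⊗[k] V} (h' : IsCrossed one R' σ') (hR : twistR R θ γ = R')
    (hσ : twistSigma R σ θ γ = σ') (hθ : θ one = 1 ⊗ₜ one)
    (hγθ : ∀ v, extOne γ (θ v) = 1 ⊗ₜ v) (hθγ : ∀ v, extOne θ (γ v) = 1 ⊗ₜ v)
    (a : A) (v : V) :
    twistEquiv h h' hR hσ hθ hγθ hθγ (CrossedProduct.of h' (a ⊗ₜ v)) =
      CrossedProduct.of h (mulId k A V (a ⊗ₜ θ v)) :=
  congrArg (CrossedProduct.of h) (extOne_tmul θ a v)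

end Twist

/-! ### The coextension `coext T G` and its behaviour under twisting and composition. -/

section Coext

variable {k C X Y Z : Type*} [Field k] [AddCommGroup C] [Module k C] [Coalgebra k C]
  [AddCommGroup X] [Module k X] [AddCommGroup Y] [Module k Y] [AddCommGroup Z] [Module k Z]

/-- `(G ⊗ id) ∘ (id ⊗ T) ∘ (Δ ⊗ id)`. -/
def coext (T : C ⊗[k] X →ₗ[k] X ⊗[k] C) (G : C ⊗[k] X →ₗ[k] Y) : C ⊗[k] X →ₗ[k] Y ⊗[k] C :=
  G.rTensor C ∘ₗ (TensorProduct.assoc k C X C).symm.toLinearMap ∘ₗ T.lTensor C ∘ₗ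
    (TensorProduct.assoc k C C X).toLinearMap ∘ₗ (comul (R := k) (A := C)).rTensor X

lemma coext_tmul (T : C ⊗[k] X →ₗ[k] X ⊗[k] C) (G : C ⊗[k] X →ₗ[k] Y) (c : C) (x : X) :
    coext T G (c ⊗ₜ x) = G.rTensor C ((TensorProduct.assoc k C X C).symm (T.lTensor C
      (TensorProduct.assoc k C C X (comul (R := k) c ⊗ₜ x)))) := rfl

lemma coext_comp (T : C ⊗[k] X →ₗ[k] X ⊗[k] C) (G : C ⊗[k] X →ₗ[k] Y) (L : Y →ₗ[k] Z) :
    coext T (L ∘ₗ G) = L.rTensor C ∘ₗ coext T G := by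
  simp only [coext, LinearMap.rTensor_comp, LinearMap.comp_assoc]

/-- `T` is compatible with the comultiplication: `(id ⊗ Δ) ∘ T = T₁₂ ∘ T₂₃ ∘ (Δ ⊗ id)`. -/
def ComulCompatible (T : C ⊗[k] X →ₗ[k] X ⊗[k] C) : Prop :=
  (comul (R := k) (A := C)).lTensor X ∘ₗ T =
    (TensorProduct.assoc k X C C).toLinearMap ∘ₗ T.rTensor C ∘ₗ
      (TensorProduct.assoc k C X C).symm.toLinearMap ∘ₗ T.lTensor C ∘ₗ
      (TensorProduct.assoc k C C X).toLinearMap ∘ₗ (comul (R := k) (A := C)).rTensor X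

/-- `coext T G` is a morphism of right comodules. -/
lemma coext_coext {T : C ⊗[k] X →ₗ[k] X ⊗[k] C} (hT : ComulCompatible T)
    (G : C ⊗[k] X →ₗ[k] Y) :
    coext T (coext T G) = (TensorProduct.assoc k Y C C).symm.toLinearMap ∘ₗ
      (comul (R := k) (A := C)).lTensor Y ∘ₗ coext T G := by
  ext c x
  -- Both sides are one linear map `L` on `C ⊗ C ⊗ C`, evaluated at the two forms of the iterated
  -- comultiplication of `c`; coassociativity then finishes.
  let B : (C ⊗[k] C) ⊗[k] X →ₗ[k] Y ⊗[k] C := G.rTensor C ∘ₗ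
    (TensorProduct.assoc k C X C).symm.toLinearMap ∘ₗ T.lTensor C ∘ₗ
    (TensorProduct.assoc k C C X).toLinearMap
  let L : (C ⊗[k] C) ⊗[k] C →ₗ[k] (Y ⊗[k] C) ⊗[k] C := B.rTensor C ∘ₗ
    (TensorProduct.assoc k (C ⊗[k] C) X C).symm.toLinearMap ∘ₗ T.lTensor (C ⊗[k] C) ∘ₗ
    (TensorProduct.assoc k (C ⊗[k] C) C X).toLinearMap ∘ₗ
    (TensorProduct.mk k ((C ⊗[k] C) ⊗[k] C) X).flip x
  have h1 : ∀ z : C ⊗[k] C, (coext T G).rTensor C ((TensorProduct.assoc k C X C).symm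
      (T.lTensor C (TensorProduct.assoc k C C X (z ⊗ₜ x)))) =
      L ((comul (R := k) (A := C)).rTensor C z) := by
    intro z
    induction z with
    | zero => simp
    | add z z' hz hz' => simp only [TensorProduct.add_tmul, map_add, hz, hz']
    | tmul a b =>
      simp only [TensorProduct.assoc_tmul, LinearMap.lTensor_tmul, LinearMap.rTensor_tmul, L,
        LinearMap.comp_apply, LinearMap.flip_apply, TensorProduct.mk_apply, LinearEquiv.coe_coe]
      generalize T (b ⊗ₜ x) = y
      induction y with
      | zero => simp
      | add y y' hy hy' => simp only [TensorProduct.tmul_add, map_add, hy, hy']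
      | tmul x' b' => simp [B, coext_tmul]
  have h2 : ∀ z : C ⊗[k] C, (TensorProduct.assoc k Y C C).symm
      ((comul (R := k) (A := C)).lTensor Y (G.rTensor C ((TensorProduct.assoc k C X C).symm
      (T.lTensor C (TensorProduct.assoc k C C X (z ⊗ₜ x)))))) =
      L ((TensorProduct.assoc k C C C).symm ((comul (R := k) (A := C)).lTensor C z)) := by
    intro z
    induction z with
    | zero => simp
    | add z z' hz hz' => simp only [TensorProduct.add_tmul, map_add, hz, hz']
    | tmul a b =>
      have h3 : ∀ y : X ⊗[k] C, (TensorProduct.assoc k Y C C).symm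
          ((comul (R := k) (A := C)).lTensor Y (G.rTensor C ((TensorProduct.assoc k C X C).symm
            (a ⊗ₜ y)))) = (TensorProduct.assoc k Y C C).symm
          ((G ∘ₗ TensorProduct.mk k C X a).rTensor (C ⊗[k] C)
            ((comul (R := k) (A := C)).lTensor X y)) := by
        intro y
        induction y with
        | zero => simp
        | add y y' hy hy' => simp only [TensorProduct.tmul_add, map_add, hy, hy']
        | tmul x' b' => simp
      rw [TensorProduct.assoc_tmul, LinearMap.lTensor_tmul, h3, LinearMap.lTensor_tmul]
      -- The compatibility of `T` with `Δ` trades the comultiplication after `T` for one before it,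
      -- followed by two applications of `T`.
      have h4 := LinearMap.congr_fun hT (b ⊗ₜ x)
      simp only [LinearMap.comp_apply, LinearEquiv.coe_coe, LinearMap.rTensor_tmul] at h4
      rw [h4]
      generalize comul (R := k) b = w
      induction w with
      | zero => simp
      | add w w' hw hw' =>
        simp only [TensorProduct.tmul_add, TensorProduct.add_tmul, map_add, hw, hw']
      | tmul p q =>
        simp only [TensorProduct.assoc_tmul, LinearMap.lTensor_tmul, L, LinearMap.comp_apply,
          LinearMap.flip_apply, TensorProduct.mk_apply, LinearEquiv.coe_coe,
          TensorProduct.assoc_symm_tmul]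
        generalize T (q ⊗ₜ x) = y
        induction y with
        | zero => simp
        | add y y' hy hy' => simp only [TensorProduct.tmul_add, map_add, hy, hy']
        | tmul x' q' =>
          simp only [TensorProduct.assoc_symm_tmul, LinearMap.rTensor_tmul, B,
            LinearMap.comp_apply, LinearEquiv.coe_coe, TensorProduct.assoc_tmul,
            LinearMap.lTensor_tmul]
          generalize T (p ⊗ₜ x') = y
          induction y with
          | zero => simp
          | add y y' hy hy' =>
            simp only [TensorProduct.tmul_add, TensorProduct.add_tmul, map_add, hy, hy']
          | tmul x'' p' => simp
  simp only [TensorProduct.AlgebraTensorModule.curry_apply, TensorProduct.curry_apply,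
    LinearMap.coe_restrictScalars, LinearMap.comp_apply, LinearEquiv.coe_coe]
  rw [coext_tmul, coext_tmul, h1, h2, coassoc_symm_apply]

/-- A morphism `j` that intertwines `T` and `T'` commutes with `coext`. -/
lemma coext_comp_lTensor {T : C ⊗[k] X →ₗ[k] X ⊗[k] C} {T' : C ⊗[k] Z →ₗ[k] Z ⊗[k] C}
    {j : X →ₗ[k] Z} (hj : T' ∘ₗ j.lTensor C = j.rTensor C ∘ₗ T) (K : C ⊗[k] Z →ₗ[k] Y) :
    coext T (K ∘ₗ j.lTensor C) = coext T' K ∘ₗ j.lTensor C := by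
  ext c x
  simp only [TensorProduct.AlgebraTensorModule.curry_apply, TensorProduct.curry_apply,
    LinearMap.coe_restrictScalars, LinearMap.comp_apply, LinearMap.lTensor_tmul, coext_tmul]
  generalize comul (R := k) c = z
  induction z with
  | zero => simp
  | add z z' hz hz' => simp only [TensorProduct.add_tmul, map_add, hz, hz']
  | tmul a b =>
    have := LinearMap.congr_fun hj (b ⊗ₜ x)
    simp only [LinearMap.comp_apply, LinearMap.lTensor_tmul] at this
    simp only [TensorProduct.assoc_tmul, LinearMap.lTensor_tmul, this]
    generalize T (b ⊗ₜ x) = y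
    induction y with
    | zero => simp
    | add y y' hy hy' => simp only [TensorProduct.tmul_add, map_add, hy, hy']
    | tmul x' b' => simp

variable {A : Type*} [Ring A] [Algebra k A]

/-- `c ⊗ x ↦ ν(c₁) G(c₂ ⊗ x)`. -/
def leftTwist (ν : C →ₗ[k] A) (G : C ⊗[k] X →ₗ[k] A) : C ⊗[k] X →ₗ[k] A :=
  LinearMap.mul' k A ∘ₗ TensorProduct.map ν G ∘ₗ
    (TensorProduct.assoc k C C X).toLinearMap ∘ₗ (comul (R := k) (A := C)).rTensor X

/-- `c ⊗ x ↦ ν(c₁) τ(c₂ ⊗ x)`, for `τ` with values in `A ⊗ C`. -/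
def leftTwistC (ν : C →ₗ[k] A) (τ : C ⊗[k] X →ₗ[k] A ⊗[k] C) : C ⊗[k] X →ₗ[k] A ⊗[k] C :=
  mulId k A C ∘ₗ TensorProduct.map ν τ ∘ₗ
    (TensorProduct.assoc k C C X).toLinearMap ∘ₗ (comul (R := k) (A := C)).rTensor X

/-- `T` touches only the last leg of the iterated comultiplication, so by coassociativity the factor
`ν(c₁)` comes out on the left. -/
lemma coext_leftTwist (T : C ⊗[k] X →ₗ[k] X ⊗[k] C) (ν : C →ₗ[k] A) (G : C ⊗[k] X →ₗ[k] A) :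
    coext T (leftTwist ν G) = leftTwistC ν (coext T G) := by
  ext c x
  let B : C ⊗[k] C →ₗ[k] A ⊗[k] C := G.rTensor C ∘ₗ
    (TensorProduct.assoc k C X C).symm.toLinearMap ∘ₗ T.lTensor C ∘ₗ
    (TensorProduct.assoc k C C X).toLinearMap ∘ₗ (TensorProduct.mk k (C ⊗[k] C) X).flip x
  let L : C ⊗[k] (C ⊗[k] C) →ₗ[k] A ⊗[k] C := mulId k A C ∘ₗ TensorProduct.map ν B
  have h1 : ∀ z : C ⊗[k] C, (leftTwist ν G).rTensor C ((TensorProduct.assoc k C X C).symm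
      (T.lTensor C (TensorProduct.assoc k C C X (z ⊗ₜ x)))) =
      L (TensorProduct.assoc k C C C ((comul (R := k) (A := C)).rTensor C z)) := by
    intro z
    induction z with
    | zero => simp
    | add z z' hz hz' => simp only [TensorProduct.add_tmul, map_add, hz, hz']
    | tmul a b =>
      have h3 : ∀ w : C ⊗[k] C, L (TensorProduct.assoc k C C C (w ⊗ₜ b)) =
          (LinearMap.mul' k A ∘ₗ TensorProduct.map ν G ∘ₗ
            (TensorProduct.assoc k C C X).toLinearMap).rTensor C
            ((TensorProduct.assoc k (C ⊗[k] C) X C).symm (w ⊗ₜ T (b ⊗ₜ x))) := by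
        intro w
        induction w with
        | zero => simp
        | add w w' hw hw' => simp only [TensorProduct.add_tmul, map_add, hw, hw']
        | tmul p q =>
          simp only [TensorProduct.assoc_tmul, L, B, LinearMap.comp_apply, TensorProduct.map_tmul,
            LinearMap.flip_apply, TensorProduct.mk_apply, LinearEquiv.coe_coe,
            LinearMap.lTensor_tmul]
          generalize T (b ⊗ₜ x) = y
          induction y with
          | zero => simp
          | add y y' hy hy' => simp only [TensorProduct.tmul_add, map_add, hy, hy']
          | tmul x' b' => simp
      simp only [TensorProduct.assoc_tmul, LinearMap.lTensor_tmul, LinearMap.rTensor_tmul, h3]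
      generalize T (b ⊗ₜ x) = y
      induction y with
      | zero => simp
      | add y y' hy hy' => simp only [TensorProduct.tmul_add, map_add, hy, hy']
      | tmul x' b' => simp [leftTwist]
  have h2 : ∀ z : C ⊗[k] C, mulId k A C (TensorProduct.map ν (coext T G)
      (TensorProduct.assoc k C C X (z ⊗ₜ x))) = L ((comul (R := k) (A := C)).lTensor C z) := by
    intro z
    induction z with
    | zero => simp
    | add z z' hz hz' => simp only [TensorProduct.add_tmul, map_add, hz, hz']
    | tmul a b => simp [L, B, coext_tmul]
  simp only [TensorProduct.AlgebraTensorModule.curry_apply, TensorProduct.curry_apply,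
    LinearMap.coe_restrictScalars]
  rw [coext_tmul, h1, coassoc_apply, ← h2]
  rfl

/-- `c ⊗ x ↦ G(c₁ ⊗ x_α) ν(c₂^α)`, where `T(c ⊗ x) = x_α ⊗ c^α`. -/
def rightTwist (T : C ⊗[k] X →ₗ[k] X ⊗[k] C) (G : C ⊗[k] X →ₗ[k] A) (ν : C →ₗ[k] A) :
    C ⊗[k] X →ₗ[k] A :=
  LinearMap.mul' k A ∘ₗ ν.lTensor A ∘ₗ coext T G

/-- The inner `coext` in `rightTwist` is doubled by the outer one. By colinearity the doubling is
`Δ` on the last leg, whose first copy feeds `ν`; that is the extension of `c ↦ ν(c₁) ⊗ c₂`. -/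
lemma coext_rightTwist {T : C ⊗[k] X →ₗ[k] X ⊗[k] C} (hT : ComulCompatible T)
    (G : C ⊗[k] X →ₗ[k] A) (ν : C →ₗ[k] A) :
    coext T (rightTwist T G ν) = extOne (ν.rTensor C ∘ₗ comul (R := k) (A := C)) ∘ₗ
      coext T G := by
  rw [rightTwist, ← LinearMap.comp_assoc, coext_comp, coext_coext hT, ← LinearMap.comp_assoc,
    ← LinearMap.comp_assoc]
  congr 1
  ext a c
  simp only [TensorProduct.AlgebraTensorModule.curry_apply, TensorProduct.curry_apply,
    LinearMap.coe_restrictScalars, LinearMap.comp_apply, LinearMap.lTensor_tmul,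
    LinearEquiv.coe_coe, extOne_tmul]
  generalize comul (R := k) c = z
  induction z with
  | zero => simp
  | add z z' hz hz' => simp only [TensorProduct.tmul_add, map_add, hz, hz']
  | tmul b d => simp

/-- The composite `T₂₃ ∘ T₁₂ : C ⊗ X ⊗ Z → X ⊗ Z ⊗ C`. -/
def compEntwining (T : C ⊗[k] X →ₗ[k] X ⊗[k] C) (S : C ⊗[k] Z →ₗ[k] Z ⊗[k] C) :
    C ⊗[k] (X ⊗[k] Z) →ₗ[k] (X ⊗[k] Z) ⊗[k] C :=
  (TensorProduct.assoc k X Z C).symm.toLinearMap ∘ₗ S.lTensor X ∘ₗ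
    (TensorProduct.assoc k X C Z).toLinearMap ∘ₗ T.rTensor Z ∘ₗ
    (TensorProduct.assoc k C X Z).symm.toLinearMap

/-- With `coext T G (c ⊗ x) = p ⊗ q`, colinearity (`coext_coext`) turns the left side into `p g(q₁ ⊗
z_β) ⊗ q₂^β`, where `S(q ⊗ z) = z_β ⊗ q^β`. This is `coext S g` applied to `q ⊗ z`, multiplied by
`p`. -/
lemma coext_compEntwining {T : C ⊗[k] X →ₗ[k] X ⊗[k] C} (hT : ComulCompatible T)
    (S : C ⊗[k] Z →ₗ[k] Z ⊗[k] C) (G : C ⊗[k] X →ₗ[k] A) (g : C ⊗[k] Z →ₗ[k] A) :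
    coext (compEntwining T S) (LinearMap.mul' k A ∘ₗ g.lTensor A ∘ₗ
        (TensorProduct.assoc k A C Z).toLinearMap ∘ₗ (coext T G).rTensor Z ∘ₗ
        (TensorProduct.assoc k C X Z).symm.toLinearMap) =
      extLeft (coext S g) ∘ₗ (coext T G).rTensor Z ∘ₗ
        (TensorProduct.assoc k C X Z).symm.toLinearMap := by
  ext c x z
  let B : (A ⊗[k] C) ⊗[k] C →ₗ[k] A ⊗[k] C := mulId k A C ∘ₗ
    (g.rTensor C ∘ₗ (TensorProduct.assoc k C Z C).symm.toLinearMap ∘ₗ S.lTensor C ∘ₗ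
      (TensorProduct.assoc k C C Z).toLinearMap ∘ₗ
      (TensorProduct.mk k (C ⊗[k] C) Z).flip z).lTensor A ∘ₗ
    (TensorProduct.assoc k A C C).toLinearMap
  have h1 : coext (compEntwining T S) (LinearMap.mul' k A ∘ₗ g.lTensor A ∘ₗ
        (TensorProduct.assoc k A C Z).toLinearMap ∘ₗ (coext T G).rTensor Z ∘ₗ
        (TensorProduct.assoc k C X Z).symm.toLinearMap) (c ⊗ₜ (x ⊗ₜ z)) =
      B (coext T (coext T G) (c ⊗ₜ x)) := by
    rw [coext_tmul, coext_tmul]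
    generalize comul (R := k) c = w
    induction w with
    | zero => simp
    | add w w' hw hw' => simp only [TensorProduct.add_tmul, map_add, hw, hw']
    | tmul a b =>
      simp only [TensorProduct.assoc_tmul, LinearMap.lTensor_tmul, compEntwining,
        LinearMap.comp_apply, LinearEquiv.coe_coe, TensorProduct.assoc_symm_tmul,
        LinearMap.rTensor_tmul]
      generalize T (b ⊗ₜ x) = y
      induction y with
      | zero => simp
      | add y y' hy hy' =>
        simp only [TensorProduct.tmul_add, TensorProduct.add_tmul, map_add, hy, hy']
      | tmul x' b' =>
        simp only [TensorProduct.assoc_tmul, LinearMap.lTensor_tmul,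
          TensorProduct.assoc_symm_tmul, LinearMap.rTensor_tmul, B, LinearMap.comp_apply,
          LinearEquiv.coe_coe]
        have h3 : ∀ y : Z ⊗[k] C, (LinearMap.mul' k A ∘ₗ g.lTensor A ∘ₗ
            (TensorProduct.assoc k A C Z).toLinearMap ∘ₗ (coext T G).rTensor Z ∘ₗ
            (TensorProduct.assoc k C X Z).symm.toLinearMap).rTensor C
              ((TensorProduct.assoc k C (X ⊗[k] Z) C).symm
                (a ⊗ₜ (TensorProduct.assoc k X Z C).symm (x' ⊗ₜ y))) =
            mulId k A C ((g.rTensor C ∘ₗ (TensorProduct.assoc k C Z C).symm.toLinearMap).lTensor A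
              (TensorProduct.assoc k A C (Z ⊗[k] C) (coext T G (a ⊗ₜ x') ⊗ₜ y))) := by
          intro y
          induction y with
          | zero => simp
          | add y y' hy hy' => simp only [TensorProduct.tmul_add, map_add, hy, hy']
          | tmul z' c' =>
            simp only [TensorProduct.assoc_symm_tmul, LinearMap.rTensor_tmul,
              LinearMap.comp_apply, LinearEquiv.coe_coe]
            generalize coext T G (a ⊗ₜ x') = v
            induction v with
            | zero => simp
            | add v v' hv hv' => simp only [TensorProduct.add_tmul, map_add, hv, hv']
            | tmul p q => simp
        rw [h3]
        generalize coext T G (a ⊗ₜ x') = v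
        induction v with
        | zero => simp
        | add v v' hv hv' => simp only [TensorProduct.add_tmul, map_add, hv, hv']
        | tmul p q => simp
  simp only [TensorProduct.AlgebraTensorModule.curry_apply, TensorProduct.curry_apply,
    LinearMap.coe_restrictScalars, LinearMap.comp_apply, LinearEquiv.coe_coe,
    TensorProduct.assoc_symm_tmul, LinearMap.rTensor_tmul] at h1 ⊢
  rw [h1, coext_coext hT]
  simp only [LinearMap.comp_apply, LinearEquiv.coe_coe]
  generalize coext T G (c ⊗ₜ x) = v
  induction v with
  | zero => simp
  | add v v' hv hv' => simp only [TensorProduct.add_tmul, map_add, hv, hv']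
  | tmul p q =>
    rw [LinearMap.lTensor_tmul, ext_tmul, coext_tmul]
    generalize comul (R := k) q = w
    induction w with
    | zero => simp
    | add w w' hw hw' =>
      simp only [TensorProduct.tmul_add, TensorProduct.add_tmul, map_add, hw, hw']
    | tmul p' q' => simp [B]

end Coext

/-! ### Compatibility of the extensions with algebra maps and with left twisting. -/

section BaseChange

variable {k A P C X : Type*} [Field k] [Ring A] [Algebra k A] [Ring P] [Algebra k P]
  [AddCommGroup C] [Module k C] [AddCommGroup X] [Module k X]

lemma rTensor_mulId (i : A →ₐ[k] P) (a : A) (x : A ⊗[k] C) :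
    i.toLinearMap.rTensor C (mulId k A C (a ⊗ₜ x)) =
      mulId k P C (i a ⊗ₜ i.toLinearMap.rTensor C x) := by
  induction x with
  | zero => simp
  | tmul b c => simp
  | add x y hx hy => simp only [TensorProduct.tmul_add, map_add, hx, hy]

lemma rTensor_extOne (i : A →ₐ[k] P) (g : C →ₗ[k] A ⊗[k] C) (x : A ⊗[k] C) :
    i.toLinearMap.rTensor C (extOne g x) =
      extOne (i.toLinearMap.rTensor C ∘ₗ g) (i.toLinearMap.rTensor C x) := by
  induction x with
  | zero => simp
  | tmul b c => simp [rTensor_mulId]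
  | add x y hx hy => simp only [map_add, hx, hy]

lemma rTensor_extLeft (i : A →ₐ[k] P) (τ : C ⊗[k] X →ₗ[k] A ⊗[k] C) (y : A ⊗[k] C) (x : X) :
    i.toLinearMap.rTensor C (extLeft τ (y ⊗ₜ x)) =
      extLeft (i.toLinearMap.rTensor C ∘ₗ τ) (i.toLinearMap.rTensor C y ⊗ₜ x) := by
  induction y with
  | zero => simp
  | tmul b c => simp [rTensor_mulId]
  | add x y hx hy => simp only [TensorProduct.add_tmul, map_add, hx, hy]

lemma extLeft_extOne_comp (g : C →ₗ[k] A ⊗[k] C) (τ : C ⊗[k] X →ₗ[k] A ⊗[k] C)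
    (y : (A ⊗[k] C) ⊗[k] X) : extLeft (extOne g ∘ₗ τ) y = extOne g (extLeft τ y) := by
  induction y with
  | zero => simp
  | add y y' hy hy' => simp only [map_add, hy, hy']
  | tmul y x =>
    induction y with
    | zero => simp
    | add y y' hy hy' => simp only [TensorProduct.add_tmul, map_add, hy, hy']
    | tmul a c => simp [extOne_mulId]

end BaseChange

section LeftTwist

variable {k A P C X : Type*} [Field k] [Ring A] [Algebra k A] [Ring P] [Algebra k P]
  [AddCommGroup C] [Module k C] [Coalgebra k C] [AddCommGroup X] [Module k X]

lemma rTensor_leftTwistC (i : A →ₐ[k] P) (ν : C →ₗ[k] A) (τ : C ⊗[k] X →ₗ[k] A ⊗[k] C) :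
    i.toLinearMap.rTensor C ∘ₗ leftTwistC ν τ =
      leftTwistC (i.toLinearMap ∘ₗ ν) (i.toLinearMap.rTensor C ∘ₗ τ) := by
  ext c x
  simp only [TensorProduct.AlgebraTensorModule.curry_apply, TensorProduct.curry_apply,
    LinearMap.coe_restrictScalars, LinearMap.comp_apply, leftTwistC, LinearMap.rTensor_tmul]
  generalize comul (R := k) c = z
  induction z with
  | zero => simp
  | add z z' hz hz' => simp only [TensorProduct.add_tmul, map_add, hz, hz']
  | tmul a b => simp [rTensor_mulId]

/-- This identifies left twisting by `ν` with precomposition by `θ(c) = ν(c₁) ⊗ c₂`, the form in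
which `R'` and `σ'` begin. -/
lemma leftTwistC_tmul (ν : C →ₗ[k] A) (τ : C ⊗[k] X →ₗ[k] A ⊗[k] C) (c : C) (x : X) :
    leftTwistC ν τ (c ⊗ₜ x) = extLeft τ (ν.rTensor C (comul (R := k) c) ⊗ₜ x) := by
  simp only [LinearMap.comp_apply, leftTwistC, LinearMap.rTensor_tmul]
  generalize comul (R := k) c = z
  induction z with
  | zero => simp
  | add z z' hz hz' => simp only [TensorProduct.add_tmul, map_add, hz, hz']
  | tmul a b => simp

lemma leftTwistC_comp_lTensor {X' : Type*} [AddCommGroup X'] [Module k X'] (ν : C →ₗ[k] A)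
    (τ : C ⊗[k] X →ₗ[k] A ⊗[k] C) (j : X' →ₗ[k] X) :
    leftTwistC ν τ ∘ₗ j.lTensor C = leftTwistC ν (τ ∘ₗ j.lTensor C) := by
  ext c x
  simp only [TensorProduct.AlgebraTensorModule.curry_apply, TensorProduct.curry_apply,
    LinearMap.coe_restrictScalars, LinearMap.comp_apply, LinearMap.lTensor_tmul,
    leftTwistC_tmul]
  generalize ν.rTensor C (comul (R := k) c) = z
  induction z with
  | zero => simp
  | add z z' hz hz' => simp only [TensorProduct.add_tmul, map_add, hz, hz']
  | tmul a b => simp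

end LeftTwist

/-! ### Twisting `F` and `f` in a crossed product by a coalgebra. -/

namespace EntwiningData

variable {k P C : Type*} [Field k] [Ring P] [Algebra k P] [AddCommGroup C]
    [Module k C] [Coalgebra k C] (E : EntwiningData k P C)

lemma preR_eq (F : C ⊗[k] P →ₗ[k] P) : E.preR F = coext E.Ψ F ∘ₗ E.incl.lTensor C := by
  ext c a
  simp [preR, coext]

lemma inclC_comp_RF (F : C ⊗[k] P →ₗ[k] P) (hF : E.MapsCoinv F) :
    E.inclC ∘ₗ E.RF F hF = coext E.Ψ F ∘ₗ E.incl.lTensor C := by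
  rw [← preR_eq]
  exact LinearMap.codRestrictOfInjective_comp _ _ _ _

lemma twistF_eq (F : C ⊗[k] P →ₗ[k] P) (ν ν' : C →ₗ[k] E.coinv) :
    E.twistF F ν ν' = leftTwist (E.incl ∘ₗ ν) (rightTwist E.Ψ F (E.incl ∘ₗ ν')) := by
  rw [rightTwist, coext, ← LinearMap.comp_assoc, ← LinearMap.comp_assoc,
    LinearMap.comp_assoc (F.rTensor C), LinearMap.lTensor_comp_rTensor, LinearMap.comp_assoc]
  rfl

lemma comulCompatible_Ψ : ComulCompatible E.Ψ := E.Ψ_comul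

lemma comulCompatible_ΨC : ComulCompatible E.ΨC := E.ΨC_comul

/-- `F` is only `P`-valued, so the computation takes place in `P ⊗ C`. The result serves twice: it
shows that `R_{F_ν}` lands in `A ⊗ C`, and it identifies `R_{F_ν}` with `R'`. -/
lemma preR_twistF (F : C ⊗[k] P →ₗ[k] P) (hF : E.MapsCoinv F) (ν ν' : C →ₗ[k] E.coinv) :
    E.preR (E.twistF F ν ν') =
      E.inclC ∘ₗ twistR (E.RF F hF) (E.coact ν) (E.coact ν') := by
  have h1 : E.preR (E.twistF F ν ν') = E.inclC ∘ₗ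
      leftTwistC ν (extOne (E.coact ν') ∘ₗ E.RF F hF) := by
    have h2 : E.inclC ∘ₗ extOne (E.coact ν') ∘ₗ E.RF F hF =
        extOne ((E.incl ∘ₗ ν').rTensor C ∘ₗ comul (R := k) (A := C)) ∘ₗ
          coext E.Ψ F ∘ₗ E.incl.lTensor C := by
      rw [← inclC_comp_RF E F hF]
      refine LinearMap.ext fun x => ?_
      have := rTensor_extOne E.coinv.val (E.coact ν') (E.RF F hF x)
      rw [coact, ← LinearMap.comp_assoc, ← LinearMap.rTensor_comp] at this
      exact this
    rw [preR_eq, twistF_eq, coext_leftTwist, coext_rightTwist E.comulCompatible_Ψ,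
      leftTwistC_comp_lTensor, LinearMap.comp_assoc, ← h2]
    exact (rTensor_leftTwistC E.coinv.val ν _).symm
  rw [h1]
  congr 1
  ext c a : 3
  simp only [TensorProduct.AlgebraTensorModule.curry_apply, TensorProduct.curry_apply,
    LinearMap.coe_restrictScalars, leftTwistC_tmul, extLeft_extOne_comp, twistR_tmul]
  rfl

/-- Up to reassociation this is the compatibility condition itself, in the form needed by
`coext_comp_lTensor`. -/
lemma Compatible.intertwines {E : EntwiningData k P C} {ν : C →ₗ[k] E.coinv}
    (hν : E.Compatible ν) :
    compEntwining E.Ψ E.ΨC ∘ₗ (E.inclC ∘ₗ E.coact ν).lTensor C =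
      (E.inclC ∘ₗ E.coact ν).rTensor C ∘ₗ E.ΨC := by
  have h1 := congrArg (fun L => (TensorProduct.assoc k P C C).symm.toLinearMap ∘ₗ L) hν
  have h2 : E.inclC ∘ₗ E.coact ν = (E.incl ∘ₗ ν).rTensor C ∘ₗ comul (R := k) (A := C) := by
    rw [LinearMap.rTensor_comp, LinearMap.comp_assoc]; rfl
  rw [h2, LinearMap.lTensor_comp, LinearMap.rTensor_comp C ((E.incl ∘ₗ ν).rTensor C)]
  refine Eq.trans ?_ (h1.trans ?_)
  · rfl
  · refine LinearMap.ext fun x => ?_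
    simp only [LinearMap.comp_apply]
    generalize (comul (R := k) (A := C)).rTensor C (E.ΨC x) = y
    simp only [LinearEquiv.coe_coe]
    induction y with
    | zero => simp
    | add y y' hy hy' => simp only [map_add, hy, hy']
    | tmul w c =>
      induction w with
      | zero => simp
      | add w w' hw hw' => simp only [TensorProduct.add_tmul, map_add, hw, hw']
      | tmul a b => simp

/-- `f_ν` is the left twist by `ν` of a map `G` that substitutes `ν(d₁) ⊗ d₂` for `d`, applies
`R_F`, and then the right twist `g` of `f`. The rules for `coext` peel off these layers one by one.
-/
lemma sigmaF_twistCocycle (F : C ⊗[k] P →ₗ[k] P) (hF : E.MapsCoinv F)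
    (f : C ⊗[k] C →ₗ[k] E.coinv) (ν ν' : C →ₗ[k] E.coinv) (hν : E.Compatible ν) :
    E.sigmaF (E.twistCocycle F hF f ν ν') =
      twistSigma (E.RF F hF) (E.sigmaF f) (E.coact ν) (E.coact ν') := by
  let g : C ⊗[k] C →ₗ[k] E.coinv := rightTwist E.ΨC f ν'
  let G : C ⊗[k] C →ₗ[k] E.coinv := LinearMap.mul' k E.coinv ∘ₗ g.lTensor E.coinv ∘ₗ
    (TensorProduct.assoc k E.coinv C C).toLinearMap ∘ₗ (E.RF F hF).rTensor C ∘ₗ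
    (TensorProduct.assoc k C E.coinv C).symm.toLinearMap ∘ₗ (E.coact ν).lTensor C
  let τ : C ⊗[k] C →ₗ[k] E.coinv ⊗[k] C := extOne (E.coact ν') ∘ₗ extLeft (E.sigmaF f) ∘ₗ
    (E.RF F hF).rTensor C ∘ₗ (TensorProduct.assoc k C E.coinv C).symm.toLinearMap ∘ₗ
    (E.coact ν).lTensor C
  have hg : coext E.ΨC g = extOne (E.coact ν') ∘ₗ E.sigmaF f :=
    coext_rightTwist E.comulCompatible_ΨC f ν'
  -- The rule for composite entwinings applies over `P`, where `Ψ` lives, so `G` is rewritten there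
  -- with `coext Ψ F` in place of `R_F`.
  have hG : E.incl ∘ₗ G = (LinearMap.mul' k P ∘ₗ (E.incl ∘ₗ g).lTensor P ∘ₗ
      (TensorProduct.assoc k P C C).toLinearMap ∘ₗ (coext E.Ψ F).rTensor C ∘ₗ
      (TensorProduct.assoc k C P C).symm.toLinearMap) ∘ₗ (E.inclC ∘ₗ E.coact ν).lTensor C := by
    ext c d
    simp only [TensorProduct.AlgebraTensorModule.curry_apply, TensorProduct.curry_apply,
      LinearMap.coe_restrictScalars, LinearMap.comp_apply, LinearMap.lTensor_tmul, G]
    generalize E.coact ν d = y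
    induction y with
    | zero => simp
    | add y y' hy hy' => simp only [TensorProduct.tmul_add, map_add, hy, hy']
    | tmul a d' =>
      have h1 : coext E.Ψ F (c ⊗ₜ E.incl a) = E.inclC (E.RF F hF (c ⊗ₜ a)) :=
        (LinearMap.congr_fun (E.inclC_comp_RF F hF) (c ⊗ₜ a)).symm
      have h2 : E.inclC (a ⊗ₜ d') = E.incl a ⊗ₜ d' := rfl
      simp only [LinearEquiv.coe_coe, TensorProduct.assoc_symm_tmul, LinearMap.rTensor_tmul, h1,
        h2]
      generalize E.RF F hF (c ⊗ₜ a) = w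
      induction w with
      | zero => simp
      | add w w' hw hw' => simp only [TensorProduct.add_tmul, map_add, hw, hw']
      | tmul p q => simp [inclC, incl]
  have hGτ : coext E.ΨC G = τ := by
    refine LinearMap.ext fun x => E.inclC_injective ?_
    have h0 : E.inclC (coext E.ΨC G x) = coext E.ΨC (E.incl ∘ₗ G) x := by
      rw [coext_comp E.ΨC G E.incl]; rfl
    -- The compatibility of `ν` is used here: it moves the substitution out of `coext`, replacing
    -- `Ψ^C` by the composite of `Ψ` and `Ψ^C`.
    rw [h0, hG, coext_comp_lTensor hν.intertwines, coext_compEntwining E.comulCompatible_Ψ,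
      coext_comp, hg]
    clear h0
    simp only [τ, LinearMap.comp_apply]
    induction x with
    | zero => simp
    | add x x' hx hx' => simp only [map_add, hx, hx']
    | tmul c d =>
      simp only [LinearMap.lTensor_tmul, LinearMap.comp_apply]
      generalize E.coact ν d = y
      induction y with
      | zero => simp
      | add y y' hy hy' => simp only [TensorProduct.tmul_add, map_add, hy, hy']
      | tmul a d' =>
        have h1 : coext E.Ψ F (c ⊗ₜ E.incl a) = E.inclC (E.RF F hF (c ⊗ₜ a)) :=
          (LinearMap.congr_fun (E.inclC_comp_RF F hF) (c ⊗ₜ a)).symm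
        have h2 : E.inclC (a ⊗ₜ d') = E.incl a ⊗ₜ d' := rfl
        simp only [LinearEquiv.coe_coe, TensorProduct.assoc_symm_tmul, LinearMap.rTensor_tmul,
          h1, h2]
        rw [← extLeft_extOne_comp]
        exact (rTensor_extLeft E.coinv.val _ _ _).symm
  have h3 : E.sigmaF (E.twistCocycle F hF f ν ν') = leftTwistC ν τ := by
    rw [← hGτ, ← coext_leftTwist]; rfl
  rw [h3]
  ext c d : 3
  simp only [TensorProduct.AlgebraTensorModule.curry_apply, TensorProduct.curry_apply,
    LinearMap.coe_restrictScalars, leftTwistC_tmul, τ, extLeft_extOne_comp, twistSigma_tmul]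
  congr 1
  change extLeft _ (E.coact ν c ⊗ₜ d) = _
  generalize E.coact ν c = y
  induction y with
  | zero => simp
  | add y y' hy hy' => simp only [TensorProduct.add_tmul, map_add, hy, hy']
  | tmul a b =>
    have h4 : ∀ w : E.coinv ⊗[k] C, crossedMul (E.RF F hF) (E.sigmaF f) ((a ⊗ₜ b) ⊗ₜ w) =
        mulId k E.coinv C (a ⊗ₜ crossedMul (E.RF F hF) (E.sigmaF f) ((1 ⊗ₜ b) ⊗ₜ w)) := by
      intro w
      rw [← crossedMul_mulId, mulId_tmul, mul_one]
    rw [h4, crossedMul_one_left]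
    simp

/-- By coassociativity the left side is `ν(c₁) ν'(c₂) ⊗ c₃`, which collapses by the convolution
identity and the counit. Used in both orders, it gives both inverse relations. -/
lemma extOne_coact {ν ν' : C →ₗ[k] E.coinv}
    (h : WithConv.toConv ν * WithConv.toConv ν' = 1) (c : C) :
    extOne (E.coact ν') (E.coact ν c) = 1 ⊗ₜ c := by
  have h1 : LinearMap.mul' k E.coinv ∘ₗ TensorProduct.map ν ν' ∘ₗ comul (R := k) (A := C) =
      Algebra.linearMap k E.coinv ∘ₗ counit (R := k) (A := C) :=
    congrArg WithConv.ofConv h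
  have h2 : ∀ z : C ⊗[k] C, extOne (E.coact ν') (ν.rTensor C z) =
      (LinearMap.mul' k E.coinv ∘ₗ TensorProduct.map ν ν').rTensor C
        ((TensorProduct.assoc k C C C).symm ((comul (R := k) (A := C)).lTensor C z)) := by
    intro z
    induction z with
    | zero => simp
    | add z z' hz hz' => simp only [map_add, hz, hz']
    | tmul a b =>
      simp only [LinearMap.rTensor_tmul, extOne_tmul, LinearMap.lTensor_tmul, coact,
        LinearMap.comp_apply]
      generalize comul (R := k) b = w
      induction w with
      | zero => simp
      | add w w' hw hw' => simp only [TensorProduct.tmul_add, map_add, hw, hw']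
      | tmul p q => simp
  change extOne (E.coact ν') (ν.rTensor C (comul (R := k) c)) = _
  rw [h2, coassoc_symm_apply, ← LinearMap.comp_apply, ← LinearMap.rTensor_comp,
    LinearMap.comp_assoc, h1, LinearMap.rTensor_comp, LinearMap.comp_apply,
    rTensor_counit_comul]
  simp

/-- At a group-like element the convolution identity reads `ν(e) ν'(e) = 1`. -/
lemma inverse_e {ν ν' : C →ₗ[k] E.coinv}
    (h : WithConv.toConv ν * WithConv.toConv ν' = 1) (he : ν E.e = 1) : ν' E.e = 1 := by
  have h1 : LinearMap.mul' k E.coinv (TensorProduct.map ν ν' (comul (R := k) E.e)) =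
      algebraMap k E.coinv (counit (R := k) E.e) :=
    LinearMap.congr_fun (congrArg WithConv.ofConv h) E.e
  simpa [E.groupLike.comul_eq_tmul_self, E.groupLike.counit_eq_one, he] using h1

lemma coact_e {ν : C →ₗ[k] E.coinv} (he : ν E.e = 1) : E.coact ν E.e = 1 ⊗ₜ E.e := by
  simp [coact, E.groupLike.comul_eq_tmul_self, he]

end EntwiningData

end CrossedProd

end

theorem mainTheorem4 {k P C : Type*} [Field k] [Ring P] [Algebra k P] [AddCommGroup C]
    [Module k C] [Coalgebra k C] (E : CrossedProd.EntwiningData k P C)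
    (F : C ⊗[k] P →ₗ[k] P) (f : C ⊗[k] C →ₗ[k] E.coinv) (h : E.IsCoalgCrossed F f)
    (ν ν' : C →ₗ[k] E.coinv)
    (hνν' : WithConv.toConv ν * WithConv.toConv ν' = 1)
    (hν'ν : WithConv.toConv ν' * WithConv.toConv ν = 1)
    (hνe : ν E.e = 1) (hν : E.Compatible ν) :
    CrossedProd.TwistConditions E.e (E.RF F h.mapsCoinv) (E.sigmaF f)
        (E.coact ν) (E.coact ν') ∧
      CrossedProd.IsCrossed E.e
        (CrossedProd.twistR (E.RF F h.mapsCoinv) (E.coact ν) (E.coact ν'))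
        (CrossedProd.twistSigma (E.RF F h.mapsCoinv) (E.sigmaF f) (E.coact ν) (E.coact ν')) ∧
      ∃ h' : E.IsCoalgCrossed (E.twistF F ν ν') (E.twistCocycle F h.mapsCoinv f ν ν'),
        CrossedProd.twistR (E.RF F h.mapsCoinv) (E.coact ν) (E.coact ν') =
            E.RF (E.twistF F ν ν') h'.mapsCoinv ∧
          CrossedProd.twistSigma (E.RF F h.mapsCoinv) (E.sigmaF f) (E.coact ν) (E.coact ν') =
            E.sigmaF (E.twistCocycle F h.mapsCoinv f ν ν') ∧
          ∃ φ : CrossedProd.EntwiningData.CoalgCrossedProduct h' ≃ₐ[k]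
              CrossedProd.EntwiningData.CoalgCrossedProduct h,
            ∀ (a : E.coinv) (c : C),
              φ (CrossedProd.CrossedProduct.of h'.isCrossed (a ⊗ₜ c)) =
                CrossedProd.CrossedProduct.of h.isCrossed
                  (CrossedProd.mulId k E.coinv C (a ⊗ₜ E.coact ν c)) := by
  have hθ := E.coact_e hνe
  have hγ := E.coact_e (E.inverse_e hνν' hνe)
  have hγθ := E.extOne_coact hνν'
  have hθγ := E.extOne_coact hν'ν
  have hpre := E.preR_twistF F h.mapsCoinv ν ν'
  have hmaps : E.MapsCoinv (E.twistF F ν ν') := fun x => ⟨_, (LinearMap.congr_fun hpre x).symm⟩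
  have hR : CrossedProd.twistR (E.RF F h.mapsCoinv) (E.coact ν) (E.coact ν') =
      E.RF (E.twistF F ν ν') hmaps := by
    -- `A ⊗ C` embeds in `P ⊗ C`, so the equality can be checked there.
    refine LinearMap.ext fun x => E.inclC_injective ?_
    exact (LinearMap.congr_fun hpre x).symm.trans
      (LinearMap.codRestrictOfInjective_comp_apply _ _ _ _ x).symm
  have hσ := (E.sigmaF_twistCocycle F h.mapsCoinv f ν ν' hν).symm
  have hcr := h.isCrossed.twist hθ hγ hγθ hθγ
  have h' : E.IsCoalgCrossed (E.twistF F ν ν') (E.twistCocycle F h.mapsCoinv f ν ν') :=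
    ⟨hmaps, by rw [← hR, ← hσ]; exact hcr⟩
  exact ⟨h.isCrossed.twistConditions hθ hγ hγθ hθγ, hcr, h', hR, hσ,
    CrossedProd.twistEquiv h.isCrossed h'.isCrossed hR hσ hθ hγθ hθγ,
    CrossedProd.twistEquiv_of_tmul h.isCrossed h'.isCrossed hR hσ hθ hγθ hθγ⟩
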